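/- All graphs are finite and simple. A graph is subcubic if its maximum degree is at most $3$, and it is $\mathcal F$-free if it contains no graph in $\mathcal F$ as a subgraph. The fractional chromatic number $\chi_f(G)$ is the infimum of $a/b$ over all positive integers $a,b$ for which one can assign to each vertex of $G$ a $b$-element subset of $\{1,\dots,a\}$ so that adjacent vertices receive disjoint sets. For a real number $t$, $G$ is fractionally $t$-critical if $\chi_f(G)>t$ but $\chi_f(H)\le t$ for every proper subgraph $H$ of $G$. *The graph $L_0$.* $L_0$ is the graph on $v_1,v_2,v_3,v_4,u_1,u_2$ with edges $v_1v_2,\ v_2v_3,\ v_3v_4,\ u_1v_1,\ u_1v_4,\ u_2v_1,\ u_2v_4$. For a proper 3-coloring $f$ of $G$, a rainbow $L_0$ is an induced copy of $L_0$ in $G$ (with vertices named as above) such that $f(u_1)=f(u_2)$, $f(v_1)=f(v_3)$, $f(v_2)=f(v_4)$, and these three colors are distinct. *Good graphs and good colorings.* A leaf is a vertex of degree one, and a support vertex is a vertex adjacent to a leaf. A graph $G$ is good if it is bipartite, subcubic, and satisfies: - (G1) no vertex of degree three is adjacent to three vertices of degree three; - (G2) for every two adjacent vertices $x,y$ of degree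 three, either at least one of $x,y$ is adjacent to a leaf, or each of $x,y$ is adjacent to a support vertex of degree two; - (G3) if $xyz$ is a path whose three vertices have degree three, each of $x$ and $z$ is adjacent to a leaf, and the neighbor $y'$ of $y$ other than $x,z$ has degree two, then the neighbor of $y'$ other than $y$ is a leaf; - (G4) if $xyz$ is a path whose three vertices have degree three and $N(z)=\{z_1,z_2,y\}$ with $\deg(z_1)\ge 2$ and $\deg(z_2)\ge 2$, then $z_1$ or $z_2$ is a support vertex of degree two. A 3-coloring $f$ of $G$ is good if it is proper, $G$ has no rainbow $L_0$ with respect to $f$, and every pair of color classes of $f$ induces a good graph. *The graphs $R_1,\dots,R_7$.* Each is obtained from $L_0$ by adding new vertices $w$ and (except for $R_3$) $y$, and the following edges: $R_1$: $wu_1,wv_3,yv_2,yw$; $R_2$: $wu_1,wv_3,yu_2,yw$; $R_3$: $wu_1,wv_3,wu_2$; $R_4$: $wu_1,wu_2,yv_2,yw$; $R_5$ and $R_6$ (the same graph): $wu_1,wv_3,yu_2,yv_2,yw$; $R_7$: $wu_1,wv_3,yv_2,yu_2$. *The family $\mathcal L'$.* Let $\mathcal L_0=\{L_0\}$, and for $i\ge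 1$ let $\mathcal L_i$ be the set of triangle-free subcubic graphs that can be obtained from some $H'\in\mathcal L_{i-1}$ either by adding a disjoint path on two vertices and two edges joining its two ends to two diagonal vertices of a $4$-cycle of $H'$, respectively, or by adding a disjoint $4$-cycle and two edges joining two diagonal vertices of it to the two ends of an edge of $H'$, respectively. Let $\mathcal L'$ be the set of triangle-free subcubic graphs $H'$ that contain a graph $H\in\bigcup_{i\ge 0}\mathcal L_i$ as a spanning subgraph with $|E(H')|>|E(H)|$. **Statement.** 1. For every real $t\ge 8/3$, every fractionally $t$-critical triangle-free subcubic graph has a good 3-coloring. 2. Every $2$-connected subcubic graph that is $\{K_3,R_1,\dots,R_7\}\cup\mathcal L'$-free has a good 3-coloring. -/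

import Mathlib

namespace GoodColoring

/-! Basic notions -/

/-- The degree of a vertex, as an extended natural number (so that no finiteness is needed). -/
noncomputable def deg {V : Type*} (G : SimpleGraph V) (v : V) : ℕ∞ :=
  (G.neighborSet v).encard

/-- A graph is subcubic if its maximum degree is at most three. -/
def IsSubcubic {V : Type*} (G : SimpleGraph V) : Prop :=
  ∀ v, deg G v ≤ 3

/-- A leaf is a vertex of degree one. -/
def IsLeaf {V : Type*} (G : SimpleGraph V) (v : V) : Prop :=
  deg G v = 1

/-- A support vertex is a vertex that is adjacent to a leaf. -/
def IsSupport {V : Type*} (G : SimpleGraph V) (v : V) : Prop :=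
  ∃ l, G.Adj v l ∧ IsLeaf G l

/-- A graph is 2-connected if it has at least three vertices, is connected,
and stays connected after the deletion of any one vertex. -/
def IsTwoConnected {V : Type*} (G : SimpleGraph V) : Prop :=
  3 ≤ Nat.card V ∧ G.Connected ∧ ∀ v : V, (G.induce {v}ᶜ).Connected

/-! Fractional colorings -/

/-- `G` has an `(a:b)`-coloring: each vertex gets a `b`-element subset of an `a`-element set,
and adjacent vertices get disjoint subsets. -/
def HasFracColoring {V : Type*} (G : SimpleGraph V) (a b : ℕ) : Prop :=
  ∃ f : V → Finset (Fin a),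
    (∀ v, (f v).card = b) ∧ ∀ x y, G.Adj x y → Disjoint (f x) (f y)

/-- The fractional chromatic number: the infimum of `a / b` over all pairs of positive integers
`a`, `b` such that `G` has an `(a:b)`-coloring. -/
noncomputable def fracChromaticNumber {V : Type*} (G : SimpleGraph V) : ℝ :=
  sInf {r : ℝ | ∃ a b : ℕ, 0 < a ∧ 0 < b ∧ HasFracColoring G a b ∧ r = (a : ℝ) / (b : ℝ)}

/-- `G` is fractionally `t`-critical if its fractional chromatic number exceeds `t`,
but that of each proper subgraph (not necessarily induced) is at most `t`. -/
def IsFracCritical {V : Type*} (t : ℝ) (G : SimpleGraph V) : Prop :=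
  t < fracChromaticNumber G ∧
    ∀ H : G.Subgraph, H ≠ ⊤ → fracChromaticNumber H.coe ≤ t

/-! The graph `L₀` and rainbow copies of it -/

/-- The graph `L₀`: a path `0, 1, 2, 3` together with two vertices `4` and `5`,
both adjacent to both ends `0` and `3` of the path. -/
def L0 : SimpleGraph (Fin 6) :=
  SimpleGraph.fromEdgeSet
    {s(0, 1), s(1, 2), s(2, 3), s(4, 0), s(4, 3), s(5, 0), s(5, 3)}

/-- A tuple `(v₁, v₂, v₃, v₄, u₁, u₂)` of six distinct vertices that forms an (induced) copy of `L₀`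
with 5-cycles `u₁v₁v₂v₃v₄u₁` and `u₂v₁v₂v₃v₄u₂` is an embedding `L0 ↪g G` with values
`v₁, v₂, v₃, v₄, u₁, u₂` at `0, 1, 2, 3, 4, 5`.  It is rainbow for the proper 3-coloring `f` if
`u₁, u₂` have one color, `v₁, v₃` a second one, and `v₂, v₄` the third one. -/
def IsRainbow {V : Type*} {G : SimpleGraph V} (f : G.Coloring (Fin 3)) (c : L0 ↪g G) : Prop :=
  ∃ p : Equiv.Perm (Fin 3),
    f (c 4) = p 0 ∧ f (c 5) = p 0 ∧
    f (c 0) = p 1 ∧ f (c 2) = p 1 ∧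
    f (c 1) = p 2 ∧ f (c 3) = p 2

/-! Good graphs and good colorings -/

/-- No vertex of degree three is adjacent to three vertices of degree three. -/
def G1 {V : Type*} (G : SimpleGraph V) : Prop :=
  ∀ v, deg G v = 3 → ¬ ∀ w, G.Adj v w → deg G w = 3

/-- For adjacent vertices `x`, `y` of degree three, one of them is adjacent to a leaf,
or each of them is adjacent to a support vertex of degree two. -/
def G2 {V : Type*} (G : SimpleGraph V) : Prop :=
  ∀ x y, G.Adj x y → deg G x = 3 → deg G y = 3 →
    ((∃ l, G.Adj x l ∧ IsLeaf G l) ∨ (∃ l, G.Adj y l ∧ IsLeaf G l)) ∨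
    ((∃ s, G.Adj x s ∧ IsSupport G s ∧ deg G s = 2) ∧
      (∃ s, G.Adj y s ∧ IsSupport G s ∧ deg G s = 2))

/-- If `x y z` is a path of vertices of degree three, both `x` and `z` are adjacent to leaves,
and the third neighbor `y'` of `y` has degree two, then the other neighbor of `y'` is a leaf. -/
def G3 {V : Type*} (G : SimpleGraph V) : Prop :=
  ∀ x y z, G.Adj x y → G.Adj y z → x ≠ z →
    deg G x = 3 → deg G y = 3 → deg G z = 3 →
    (∃ l, G.Adj x l ∧ IsLeaf G l) → (∃ l, G.Adj z l ∧ IsLeaf G l) →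
    ∀ y', G.Adj y y' → y' ≠ x → y' ≠ z → deg G y' = 2 →
      ∀ w, G.Adj y' w → w ≠ y → IsLeaf G w

/-- If `x y z` is a path of vertices of degree three and the neighbors `z₁`, `z₂` of `z` other
than `y` have degree at least two, then `z₁` or `z₂` is a support vertex of degree two. -/
def G4 {V : Type*} (G : SimpleGraph V) : Prop :=
  ∀ x y z z₁ z₂, G.Adj x y → G.Adj y z → x ≠ z →
    deg G x = 3 → deg G y = 3 → deg G z = 3 →
    G.neighborSet z = {z₁, z₂, y} → 2 ≤ deg G z₁ → 2 ≤ deg G z₂ →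
    (IsSupport G z₁ ∧ deg G z₁ = 2) ∨ (IsSupport G z₂ ∧ deg G z₂ = 2)

/-- A graph is good if it is bipartite, subcubic, and satisfies the four conditions above. -/
def IsGoodGraph {V : Type*} (G : SimpleGraph V) : Prop :=
  G.IsBipartite ∧ IsSubcubic G ∧ G1 G ∧ G2 G ∧ G3 G ∧ G4 G

/-- A proper 3-coloring is good if it has no rainbow copy of `L₀` and every pair of its color
classes induces a good graph. -/
def IsGoodColoring {V : Type*} {G : SimpleGraph V} (f : G.Coloring (Fin 3)) : Prop :=
  (∀ c : L0 ↪g G, ¬ IsRainbow f c) ∧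
    ∀ i j : Fin 3, i ≠ j → IsGoodGraph (G.induce {v | f v = i ∨ f v = j})

/-! The graphs `R₁, …, R₇`.  Each one consists of a copy of `L₀` on `0, …, 5`
(named as in `L0`) and one or two further vertices `6`, `7`. -/

def R1 : SimpleGraph (Fin 8) :=
  SimpleGraph.fromEdgeSet
    {s(0, 1), s(1, 2), s(2, 3), s(4, 0), s(4, 3), s(5, 0), s(5, 3),
      s(6, 4), s(6, 2), s(7, 1), s(7, 6)}

def R2 : SimpleGraph (Fin 8) :=
  SimpleGraph.fromEdgeSet
    {s(0, 1), s(1, 2), s(2, 3), s(4, 0), s(4, 3), s(5, 0), s(5, 3),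
      s(6, 4), s(6, 2), s(7, 5), s(7, 6)}

def R3 : SimpleGraph (Fin 7) :=
  SimpleGraph.fromEdgeSet
    {s(0, 1), s(1, 2), s(2, 3), s(4, 0), s(4, 3), s(5, 0), s(5, 3),
      s(6, 4), s(6, 2), s(6, 5)}

def R4 : SimpleGraph (Fin 8) :=
  SimpleGraph.fromEdgeSet
    {s(0, 1), s(1, 2), s(2, 3), s(4, 0), s(4, 3), s(5, 0), s(5, 3),
      s(6, 4), s(6, 5), s(7, 1), s(7, 6)}

def R5 : SimpleGraph (Fin 8) :=
  SimpleGraph.fromEdgeSet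
    {s(0, 1), s(1, 2), s(2, 3), s(4, 0), s(4, 3), s(5, 0), s(5, 3),
      s(6, 4), s(6, 2), s(7, 5), s(7, 1), s(7, 6)}

/-- The pictures of `R₅` and `R₆` differ, but the graphs drawn are the same. -/
def R6 : SimpleGraph (Fin 8) :=
  SimpleGraph.fromEdgeSet
    {s(0, 1), s(1, 2), s(2, 3), s(4, 0), s(4, 3), s(5, 0), s(5, 3),
      s(6, 4), s(6, 2), s(7, 1), s(7, 5), s(7, 6)}

def R7 : SimpleGraph (Fin 8) :=
  SimpleGraph.fromEdgeSet
    {s(0, 1), s(1, 2), s(2, 3), s(4, 0), s(4, 3), s(5, 0), s(5, 3),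
      s(6, 4), s(6, 2), s(7, 1), s(7, 5)}

/-- `G` contains none of `R₁, …, R₇` as a subgraph. -/
def IsRFree {V : Type*} (G : SimpleGraph V) : Prop :=
  R1.Free G ∧ R2.Free G ∧ R3.Free G ∧ R4.Free G ∧ R5.Free G ∧ R6.Free G ∧ R7.Free G

/-! The families `ℒᵢ` and `ℒ'` -/

/-- Add a disjoint path on two vertices, and join one end of it to `a` and the other end to `c`. -/
def addEdgePair {V : Type*} (H : SimpleGraph V) (a c : V) : SimpleGraph (V ⊕ Fin 2) :=
  (H ⊕g (⊤ : SimpleGraph (Fin 2))) ⊔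
    SimpleGraph.fromEdgeSet {s(Sum.inl a, Sum.inr 0), s(Sum.inl c, Sum.inr 1)}

/-- Add a disjoint cycle on four vertices, and join two diagonal vertices of it to `x` and `y`. -/
def addFourCycle {V : Type*} (H : SimpleGraph V) (x y : V) : SimpleGraph (V ⊕ Fin 4) :=
  (H ⊕g SimpleGraph.cycleGraph 4) ⊔
    SimpleGraph.fromEdgeSet {s(Sum.inl x, Sum.inr 0), s(Sum.inl y, Sum.inr 2)}

/-- `LFamily i H` says that `H` is (up to isomorphism) in `ℒᵢ`.  Here `ℒ₀ = {L₀}`, and `ℒᵢ₊₁` consists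
of the triangle-free subcubic graphs obtained from a graph `H'` in `ℒᵢ` in one of two ways:
adding a disjoint path on two vertices whose ends are joined to two diagonal vertices
`a`, `c` of a 4-cycle `a b c d` of `H'`, respectively, or adding a disjoint 4-cycle of which two
diagonal vertices are joined to the two ends `x`, `y` of an edge of `H'`, respectively. -/
inductive LFamily : ℕ → {V : Type} → SimpleGraph V → Prop
  | base {V : Type} {H : SimpleGraph V} (e : Nonempty (H ≃g L0)) : LFamily 0 H
  | op1 {i : ℕ} {V W : Type} {H' : SimpleGraph V} {H : SimpleGraph W}
      (h : LFamily i H') (a b c d : V) (hab : H'.Adj a b) (hbc : H'.Adj b c)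
      (hcd : H'.Adj c d) (hda : H'.Adj d a) (hac : a ≠ c) (hbd : b ≠ d)
      (e : Nonempty (H ≃g addEdgePair H' a c))
      (ht : H.CliqueFree 3) (hs : IsSubcubic H) : LFamily (i + 1) H
  | op2 {i : ℕ} {V W : Type} {H' : SimpleGraph V} {H : SimpleGraph W}
      (h : LFamily i H') (x y : V) (hxy : H'.Adj x y)
      (e : Nonempty (H ≃g addFourCycle H' x y))
      (ht : H.CliqueFree 3) (hs : IsSubcubic H) : LFamily (i + 1) H

/-- The family `ℒ'`: triangle-free subcubic graphs that contain a graph in some `ℒᵢ` as a spanning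
subgraph and have more edges than it (for these finite graphs, this is strict inclusion). -/
def LPrime {V : Type} (H' : SimpleGraph V) : Prop :=
  H'.CliqueFree 3 ∧ IsSubcubic H' ∧ ∃ (i : ℕ) (H : SimpleGraph V), LFamily i H ∧ H < H'

/-- `G` contains no graph in `ℒ'` as a subgraph. -/
def IsLPrimeFree {V : Type*} (G : SimpleGraph V) : Prop :=
  ∀ (W : Type) (H : SimpleGraph W), LPrime H → H.Free G

end GoodColoring

open GoodColoring

namespace GoodColoring

/-! ### Brooks' theorem for subcubic graphs -/

section Brooks

variable {W : Type*} {H : SimpleGraph W}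

/-- Every vertex has at most three neighbors. -/
def DegLeThree (H : SimpleGraph W) : Prop :=
  ∀ v, ∃ a b c, ∀ w, H.Adj v w → w = a ∨ w = b ∨ w = c

/-- The restriction of `f` to `S` is a proper coloring. -/
def ProperOn (H : SimpleGraph W) (f : W → Fin 3) (S : Set W) : Prop :=
  ∀ x ∈ S, ∀ y ∈ S, H.Adj x y → f x ≠ f y

lemma DegLeThree.eq_of_adj (h3 : DegLeThree H) {x a b c z : W} (ha : H.Adj x a)
    (hb : H.Adj x b) (hc : H.Adj x c) (hab : a ≠ b) (hac : a ≠ c) (hbc : b ≠ c)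
    (hz : H.Adj x z) : z = a ∨ z = b ∨ z = c := by
  obtain ⟨p, q, r, h⟩ := h3 x
  have h1 := h a ha
  have h2 := h b hb
  have h3 := h c hc
  have h4 := h z hz
  grind

lemma exists_color_ne (p q : Fin 3) : ∃ c : Fin 3, c ≠ p ∧ c ≠ q := by
  revert p q; decide

lemma ProperOn.mono {f : W → Fin 3} {S S' : Set W} (hf : ProperOn H f S) (h : S' ⊆ S) :
    ProperOn H f S' := fun x hx y hy => hf x (h hx) y (h hy)

open Classical in
lemma ProperOn.update {f : W → Fin 3} {S : Set W} (hf : ProperOn H f S) {v : W} (hv : v ∉ S)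
    {c : Fin 3} (hc : ∀ y ∈ S, H.Adj v y → f y ≠ c) :
    ProperOn H (Function.update f v c) (insert v S) := by
  intro x hx y hy hxy
  rcases eq_or_ne x v with rfl | hxv <;> rcases eq_or_ne y x with rfl | hyv
  · exact absurd rfl hxy.ne
  · have := hc y (by simpa [hyv] using hy) hxy
    simpa [hyv] using this.symm
  · exact absurd rfl hxy.ne
  · rcases eq_or_ne y v with rfl | hyv'
    · have := hc x (by simpa [hxv] using hx) hxy.symm
      simpa [hxv] using this
    · simpa [hxv, hyv'] using hf x (by simpa [hxv] using hx) y (by simpa [hyv'] using hy) hxy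

/-- Two neighbors of `v` in `S` have the same color. -/
def HasSlack (H : SimpleGraph W) (f : W → Fin 3) (S : Set W) (v : W) : Prop :=
  ∃ a b, H.Adj v a ∧ H.Adj v b ∧ a ≠ b ∧ a ∈ S ∧ b ∈ S ∧ f a = f b

lemma ProperOn.exists_insert {f : W → Fin 3} {S : Set W} (hf : ProperOn H f S) {v : W}
    (hv : v ∉ S) (h : ∃ p q : Fin 3, ∀ y ∈ S, H.Adj v y → f y = p ∨ f y = q) :
    ∃ f' : W → Fin 3, (∀ x ∈ S, f' x = f x) ∧ ProperOn H f' (insert v S) := by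
  classical
  obtain ⟨p, q, h⟩ := h
  obtain ⟨c, hp, hq⟩ := exists_color_ne p q
  refine ⟨Function.update f v c, fun x hx => ?_, hf.update hv fun y hy hvy => ?_⟩
  · rw [Function.update_of_ne]; rintro rfl; exact hv hx
  · rcases h y hy hvy with h | h <;> rw [h] <;> tauto

lemma DegLeThree.colors_of_slack (h3 : DegLeThree H) {f : W → Fin 3} {S : Set W} {v : W}
    (h : HasSlack H f S v) : ∃ p q : Fin 3, ∀ y ∈ S, H.Adj v y → f y = p ∨ f y = q := by
  obtain ⟨a, b, ha, hb, hab, -, -, hf⟩ := h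
  by_cases hc : ∃ c, H.Adj v c ∧ c ≠ a ∧ c ≠ b
  · obtain ⟨c, hc, hca, hcb⟩ := hc
    refine ⟨f a, f c, fun y _ hy => ?_⟩
    rcases h3.eq_of_adj ha hb hc hab hca.symm hcb.symm hy with rfl | rfl | rfl <;> simp [hf]
  · push Not at hc
    refine ⟨f a, f b, fun y _ hy => ?_⟩
    by_cases hya : y = a
    · simp [hya]
    · simp [hc y hy hya]

lemma DegLeThree.colors_of_outside (h3 : DegLeThree H) {f : W → Fin 3} {S : Set W} {v u : W}
    (hu : H.Adj v u) (huS : u ∉ S) :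
    ∃ p q : Fin 3, ∀ y ∈ S, H.Adj v y → f y = p ∨ f y = q := by
  obtain ⟨a, b, c, h⟩ := h3 v
  have key : ∃ p q, ∀ y ∈ S, H.Adj v y → y = p ∨ y = q := by
    rcases h u hu with rfl | rfl | rfl
    · exact ⟨b, c, fun y hy hvy => by have := h y hvy; grind⟩
    · exact ⟨a, c, fun y hy hvy => by have := h y hvy; grind⟩
    · exact ⟨a, b, fun y hy hvy => by have := h y hvy; grind⟩
  obtain ⟨p, q, key⟩ := key
  exact ⟨f p, f q, fun y hy hvy => by rcases key y hy hvy with rfl | rfl <;> simp⟩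

/-- Coloring a path greedily, from its first vertex to its last. -/
lemma DegLeThree.extend_path (h3 : DegLeThree H) (l : List W) (hl : l.IsChain H.Adj)
    (hnd : l.Nodup) (f : W → Fin 3) (S : Set W) (hf : ProperOn H f S) (hlS : ∀ x ∈ l, x ∉ S)
    (hlast : ∀ z ∈ l.getLast?, (∃ u, H.Adj z u ∧ u ∉ S ∧ u ∉ l) ∨ HasSlack H f S z) :
    ∃ f' : W → Fin 3, (∀ x ∈ S, f' x = f x) ∧ ProperOn H f' (S ∪ {x | x ∈ l}) := by
  induction l generalizing f S with
  | nil => exact ⟨f, fun _ _ => rfl, by simpa using hf⟩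
  | cons x l ih =>
    have hxS := hlS x (by simp)
    have hcol : ∃ p q : Fin 3, ∀ y ∈ S, H.Adj x y → f y = p ∨ f y = q := by
      cases l with
      | nil =>
        rcases hlast x (by simp) with ⟨u, hu, huS, -⟩ | h
        · exact h3.colors_of_outside hu huS
        · exact h3.colors_of_slack h
      | cons y l =>
        exact h3.colors_of_outside (List.isChain_cons_cons.1 hl).1 (hlS y (by simp))
    obtain ⟨f1, hf1, hp⟩ := hf.exists_insert hxS hcol
    rw [List.nodup_cons] at hnd
    obtain ⟨f2, hf2, hp2⟩ := ih hl.of_cons hnd.2 f1 (insert x S) hp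
      (fun y hy => by
        have := hlS y (by simp [hy])
        have hyx : y ≠ x := by rintro rfl; exact hnd.1 hy
        simp [this, hyx])
      (fun z hz => by
        have hz' : z ∈ (x :: l).getLast? := by
          cases l with
          | nil => simp at hz
          | cons y l => simpa [List.getLast?_cons_cons] using hz
        rcases hlast z hz' with ⟨u, hu, huS, hul⟩ | ⟨a, b, ha, hb, hab, haS, hbS, h⟩
        · left; exact ⟨u, hu, by simp at hul ⊢; tauto, by simp at hul ⊢; tauto⟩
        · right; exact ⟨a, b, ha, hb, hab, by simp [haS], by simp [hbS], by
            rw [hf1 a haS, hf1 b hbS, h]⟩)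
    refine ⟨f2, fun y hy => ?_, hp2.mono ?_⟩
    · rw [hf2 y (by simp [hy]), hf1 y hy]
    · intro y; simp; tauto

lemma List.exists_first_split {α : Type*} (p : α → Prop) (l : List α) (h : ∃ x ∈ l, p x) :
    ∃ A c B, l = A ++ c :: B ∧ (∀ x ∈ A, ¬ p x) ∧ p c := by
  classical
  induction l with
  | nil => simp at h
  | cons a l ih =>
    by_cases ha : p a
    · exact ⟨[], a, l, rfl, by simp, ha⟩
    · obtain ⟨A, c, B, rfl, hA, hc⟩ := ih (by simpa [ha] using h)
      exact ⟨a :: A, c, B, rfl, by simpa [ha] using hA, hc⟩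

lemma List.exists_last_split {α : Type*} (p : α → Prop) (l : List α) (h : ∃ x ∈ l, p x) :
    ∃ A c B, l = A ++ c :: B ∧ (∀ x ∈ B, ¬ p x) ∧ p c := by
  obtain ⟨A, c, B, hl, hA, hc⟩ := List.exists_first_split p l.reverse (by simpa using h)
  refine ⟨B.reverse, c, A.reverse, ?_, by simpa using hA, hc⟩
  rw [← l.reverse_reverse, hl]; simp

lemma isChain_adj_reverse {l : List W} (h : l.IsChain H.Adj) : l.reverse.IsChain H.Adj := by
  rw [List.isChain_reverse]
  exact h.imp fun _ _ h => h.symm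

/-- A longest path in `S` that ends with the path `m`. -/
lemma exists_maximal_path [Finite W] (S : Set W) (m : List W) (hm : m.IsChain H.Adj)
    (hnd : m.Nodup) (hmS : ∀ x ∈ m, x ∈ S) :
    ∃ q : List W, (q ++ m).IsChain H.Adj ∧ (q ++ m).Nodup ∧ (∀ x ∈ q ++ m, x ∈ S) ∧
      ∀ h ∈ (q ++ m).head?, ∀ z ∈ S, H.Adj h z → z ∈ q ++ m := by
  classical
  have := Fintype.ofFinite W
  let P : ℕ → Prop := fun n => ∃ q : List W, q.length = n ∧ (q ++ m).IsChain H.Adj ∧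
    (q ++ m).Nodup ∧ ∀ x ∈ q ++ m, x ∈ S
  have hb : ∀ n, P n → n ≤ Fintype.card W := by
    rintro n ⟨q, rfl, -, h, -⟩
    exact (List.nodup_append.1 h).1.length_le_card
  have h0 : P 0 := ⟨[], rfl, hm, hnd, hmS⟩
  obtain ⟨n, ⟨q, rfl, hc, hn, hS⟩, hmax⟩ : ∃ n, P n ∧ ∀ k, P k → k ≤ n :=
    ⟨_, Nat.findGreatest_spec (P := P) (Nat.zero_le _) h0,
      fun k hk => Nat.le_findGreatest (hb k hk) hk⟩
  refine ⟨q, hc, hn, hS, fun h hh z hz hhz => ?_⟩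
  by_contra hzq
  have hP : P (q.length + 1) := by
    refine ⟨z :: q, rfl, ?_, ?_, ?_⟩
    · rw [List.cons_append, List.isChain_cons]
      exact ⟨fun y hy => by
        rw [Option.mem_def] at hh hy; rw [hh] at hy; cases hy; exact hhz.symm, hc⟩
    · rw [List.cons_append, List.nodup_cons]; exact ⟨hzq, hn⟩
    · simpa [hz] using hS
  have := hmax _ hP
  omega

/-- The inductive step of Brooks' theorem when some path cannot be extended
and does not contain all vertices of `S`. -/
lemma DegLeThree.properOn_of_cycle (h3 : DegLeThree H) {S : Set W}
    (ih : ∀ S' ⊂ S, ∃ f, ProperOn H f S') {C : List W} {h q : W} {t : List W}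
    (hC : C = h :: t) (hq : q ∈ C.getLast?) (hhq : H.Adj h q)
    (hchain : C.IsChain H.Adj) (hnd : C.Nodup) (hCS : {x | x ∈ C} ⊂ S)
    (hh : ∀ z ∈ S, H.Adj h z → z ∈ C) : ∃ f, ProperOn H f S := by
  classical
  have hsub : S \ {x | x ∈ C} ⊂ S := by
    refine ⟨Set.sdiff_subset, fun hle => ?_⟩
    have := hle (hCS.1 (show h ∈ {x | x ∈ C} by simp [hC]))
    simp [hC] at this
  obtain ⟨f, hf⟩ := ih _ hsub
  by_cases hout : ∃ c ∈ C, ∃ u ∈ S, u ∉ C ∧ H.Adj c u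
  · obtain ⟨P, c, R, hsplit, hP, u, huS, huC, hcu⟩ := List.exists_first_split _ _ hout
    have hPne : P ≠ [] := by
      rintro rfl
      rw [hsplit] at hC
      simp at hC
      rw [hC.1] at hcu
      exact huC (hh u huS hcu)
    obtain ⟨P0, d, rfl⟩ : ∃ P0 d, P = P0 ++ [d] := ⟨P.dropLast, P.getLast hPne, (List.dropLast_append_getLast hPne).symm⟩
    have hdc : H.Adj d c := by
      rw [hsplit, List.isChain_append] at hchain
      exact hchain.2.2 d (by simp) c (by simp)
    have hdC : d ∈ C := by simp [hsplit]
    have hd : ∀ z ∈ S, H.Adj d z → z ∈ C := by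
      intro z hz hdz
      by_contra hzC
      exact hP d (by simp) ⟨z, hz, hzC, hdz⟩
    have hf1 : ProperOn H (Function.update f d (f u)) (insert d (S \ {x | x ∈ C})) :=
      hf.update (by simp [hdC]) fun y hy hdy => absurd (hd y hy.1 hdy) hy.2
    have hnd' := hnd
    rw [hsplit] at hnd'
    have hdu : u ≠ d := by rintro rfl; exact huC hdC
    obtain ⟨f2, -, hf2⟩ := h3.extend_path (P0.reverse ++ (c :: R).reverse) (by
        rw [List.isChain_append]
        rw [hsplit, List.append_assoc, List.isChain_append] at hchain
        refine ⟨isChain_adj_reverse hchain.1, isChain_adj_reverse ?_, fun x hx y hy => ?_⟩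
        · have := hchain.2.1
          rw [List.isChain_append] at this
          exact this.2.1
        · rw [List.getLast?_reverse] at hx
          rw [List.head?_reverse] at hy
          have hxh : x = h := by
            cases P0 with
            | nil => cases hx
            | cons p P0 =>
              simp at hx
              rw [hsplit] at hC
              simp at hC
              rw [← hx, hC.1]
          have hyq : y = q := by
            rw [hsplit] at hq
            rw [List.getLast?_append_of_ne_nil _ (by simp)] at hq
            rw [Option.mem_def] at hq hy
            rw [hq] at hy
            exact (Option.some.inj hy).symm
          rw [hxh, hyq]; exact hhq)
      (by
        rw [List.append_assoc, List.nodup_append] at hnd'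
        have h2 := hnd'.2.1
        rw [List.nodup_append] at h2
        rw [List.nodup_append]
        refine ⟨List.nodup_reverse.2 hnd'.1, List.nodup_reverse.2 h2.2.1, fun a ha b hb => ?_⟩
        exact hnd'.2.2 a (by simpa using ha) b (by
          rw [List.mem_reverse] at hb
          exact List.mem_append_right _ hb))
      _ _ hf1
      (by
        intro x hx
        have hxC : x ∈ C := by
          rw [hsplit]; simp at hx ⊢; tauto
        have hxd : x ≠ d := by
          rintro rfl
          simp only [List.mem_append, List.mem_reverse] at hx
          rw [List.append_assoc, List.nodup_append] at hnd'
          rcases hx with hx | hx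
          · exact hnd'.2.2 x hx x (by simp) rfl
          · have h2 := hnd'.2.1
            rw [List.nodup_append] at h2
            exact h2.2.2 x (by simp) x hx rfl
        simp [hxd, hxC])
      (by
        intro z hz
        have : z = c := by
          rw [List.getLast?_append_of_ne_nil _ (by simp)] at hz
          simp at hz; exact hz.symm
        subst this
        right
        refine ⟨u, d, hcu, hdc.symm, hdu, by simp [huS, huC], by simp, ?_⟩
        simp [Function.update_of_ne hdu])
    refine ⟨f2, hf2.mono fun x hx => ?_⟩
    by_cases hxC : x ∈ C
    · rw [hsplit] at hxC
      simp at hxC ⊢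
      tauto
    · left; right; exact ⟨hx, hxC⟩
  · push Not at hout
    obtain ⟨g, hg⟩ := ih _ hCS
    refine ⟨fun x => if x ∈ C then g x else f x, fun x hx y hy hxy => ?_⟩
    by_cases hxC : x ∈ C <;> by_cases hyC : y ∈ C <;> simp only [hxC, hyC, if_true, if_false]
    · exact hg x hxC y hyC hxy
    · exact absurd hxy (hout x hxC y hy hyC)
    · exact absurd hxy.symm (hout y hyC x hx hxC)
    · exact hf x ⟨hx, hxC⟩ y ⟨hy, hyC⟩ hxy

/-- The inductive step of Brooks' theorem when there is a Hamiltonian path that ends with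
`y`, `v`, `x`, where `x` and `y` are not adjacent. -/
lemma DegLeThree.properOn_of_hamiltonian (h3 : DegLeThree H) {S : Set W} {Q : List W}
    {x v y m : W} (hchain : (Q ++ [y, v, x]).IsChain H.Adj) (hnd : (Q ++ [y, v, x]).Nodup)
    (hS : ∀ z ∈ S, z ∈ Q ++ [y, v, x]) (hxy : ¬ H.Adj x y) (hvm : H.Adj v m) (hm : m ∈ Q) :
    ∃ f, ProperOn H f S := by
  classical
  obtain ⟨A, B, rfl⟩ := List.append_of_mem hm
  simp only [List.append_assoc, List.cons_append] at hchain hnd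
  rw [List.isChain_append, List.isChain_cons, List.isChain_append] at hchain
  obtain ⟨hA, ⟨hmB, hB, hvx, -⟩, hAm⟩ := hchain
  rw [List.nodup_append, List.nodup_cons, List.nodup_append] at hnd
  obtain ⟨hA', ⟨hmB', hB', hvx', hBv⟩, hAm'⟩ := hnd
  simp only [List.isChain_cons_cons] at hvx
  obtain ⟨hyv, hvx, -⟩ := hvx
  have hdist : y ≠ v ∧ y ≠ x ∧ v ≠ x := by simp at hvx'; tauto
  have h0 : ProperOn H (fun _ => (0 : Fin 3)) {x, y} := by
    rintro a (rfl | rfl) b (rfl | rfl) hab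
    · exact absurd rfl hab.ne
    · exact absurd hab hxy
    · exact absurd hab.symm hxy
    · exact absurd rfl hab.ne
  obtain ⟨f1, hf1, hp1⟩ := h3.extend_path B.reverse (isChain_adj_reverse hB)
    (List.nodup_reverse.2 hB') _ _ h0
    (by
      intro z hz
      rw [List.mem_reverse] at hz
      have h1 := hBv z hz x (by simp)
      have h2 := hBv z hz y (by simp)
      simp [h1, h2])
    (by
      intro z hz
      rw [List.getLast?_reverse] at hz
      left
      refine ⟨m, (hmB z ?_).symm, ?_, ?_⟩
      · cases B with
        | nil => simp at hz
        | cons b B => simpa using hz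
      · simp at hmB' ⊢; tauto
      · simp at hmB' ⊢; tauto)
  obtain ⟨f2, hf2, hp2⟩ := h3.extend_path (A ++ [m])
    (by
      rw [List.isChain_append]
      exact ⟨hA, by simp, fun a ha b hb => hAm a ha b (by simpa using hb)⟩)
    (by
      rw [List.nodup_append]
      exact ⟨hA', by simp, fun a ha b hb => hAm' a ha b (by simp at hb; simp [hb])⟩)
    _ _ hp1
    (by
      intro z hz
      simp only [List.mem_append, List.mem_singleton] at hz
      rcases hz with hz | rfl
      · have h1 := hAm' z hz
        have hzx := h1 x (by simp)
        have hzy := h1 y (by simp)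
        have hzB : z ∉ B := fun hzB => h1 z (by simp [hzB]) rfl
        simp [hzx, hzy, hzB]
      · simp at hmB' ⊢; tauto)
    (by
      intro z hz
      simp at hz
      subst hz
      left
      refine ⟨v, hvm.symm, ?_, ?_⟩
      · have : v ∉ B := fun hvB => hBv v hvB v (by simp) rfl
        simp [this, hdist.2.2, hdist.1.symm]
      · have : v ∉ A := fun hvA => hAm' v hvA v (by simp) rfl
        simp [this, hvm.ne])
  obtain ⟨f3, -, hp3⟩ := hp2.exists_insert (v := v)
    (by
      have h1 : v ∉ A := fun hvA => hAm' v hvA v (by simp) rfl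
      have h2 : v ∉ B := fun hvB => hBv v hvB v (by simp) rfl
      simp [h1, h2, hdist.2.2, hdist.1.symm, hvm.ne])
    (h3.colors_of_slack ⟨x, y, hvx, hyv.symm, hdist.2.1.symm, by simp, by simp, by
      rw [hf2 x (by simp), hf2 y (by simp), hf1 x (by simp), hf1 y (by simp)]⟩)
  refine ⟨f3, hp3.mono fun z hz => ?_⟩
  have := hS z hz
  simp at this ⊢
  tauto

/-- Brooks' theorem for graphs of maximum degree at most three. -/
theorem DegLeThree.exists_coloring [Finite W] (h3 : DegLeThree H)
    (h4 : ∀ a b c d, H.Adj a b → H.Adj a c → H.Adj a d → H.Adj b c → H.Adj b d → ¬ H.Adj c d) :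
    ∃ f : W → Fin 3, ∀ x y, H.Adj x y → f x ≠ f y := by
  classical
  suffices h : ∀ S : Set W, ∃ f, ProperOn H f S by
    obtain ⟨f, hf⟩ := h Set.univ
    exact ⟨f, fun x y => hf x trivial y trivial⟩
  intro S
  induction S using WellFoundedLT.induction with
  | ind S ih => ?_
  by_cases hlow : ∃ v ∈ S, ∃ a b, ∀ y ∈ S, H.Adj v y → y = a ∨ y = b
  · obtain ⟨v, hv, a, b, hab⟩ := hlow
    obtain ⟨f, hf⟩ := ih (S \ {v}) ⟨Set.sdiff_subset, fun hle => (hle hv).2 rfl⟩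
    obtain ⟨g, -, hg⟩ := hf.exists_insert (v := v) (by simp)
      ⟨f a, f b, fun y hy hvy => by rcases hab y hy.1 hvy with rfl | rfl <;> simp⟩
    exact ⟨g, hg.mono fun z hz => by by_cases h : z = v <;> simp [h, hz]⟩
  have hhigh : ∀ v ∈ S, ∃ a b c, a ∈ S ∧ b ∈ S ∧ c ∈ S ∧ H.Adj v a ∧ H.Adj v b ∧ H.Adj v c ∧
      a ≠ b ∧ a ≠ c ∧ b ≠ c := by
    intro v hv
    obtain ⟨a, b, c, habc⟩ := h3 v
    by_contra hcon
    push Not at hlow hcon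
    obtain ⟨x, hx, hvx, hxa, hxb⟩ := hlow v hv a b
    obtain ⟨y, hy, hvy, hya, hyc⟩ := hlow v hv a c
    obtain ⟨z, hz, hvz, hzb, hzc⟩ := hlow v hv b c
    have h1 := habc x hvx
    have h2 := habc y hvy
    have h3 := habc z hvz
    have := hcon x y z hx hy hz hvx hvy hvz
    grind
  have claim : ∀ v x y m, v ∈ S → x ∈ S → y ∈ S → m ∈ S → H.Adj v x → H.Adj v y → H.Adj v m →
      x ≠ y → x ≠ m → y ≠ m → ¬ H.Adj x y → ∃ f, ProperOn H f S := by
    intro v x y m hv hx hy hm hvx hvy hvm hxy hxm hym hnadj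
    obtain ⟨q, hc, hn, hS, hmax⟩ := exists_maximal_path (H := H) S [y, v, x]
      (by simp [hvx, hvy.symm]) (by simp [hvy.ne', hvx.ne, hxy.symm]) (by simp [hv, hx, hy])
    by_cases hall : ∀ z ∈ S, z ∈ q ++ [y, v, x]
    · refine h3.properOn_of_hamiltonian hc hn hall hnadj hvm ?_
      have := hall m hm
      simpa [hym.symm, hxm.symm, hvm.ne'] using this
    · push Not at hall
      obtain ⟨z, hzS, hz⟩ := hall
      obtain ⟨h, t, hl⟩ : ∃ h t, q ++ [y, v, x] = h :: t := by
        cases q <;> simp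
      rw [hl] at hc hn hS hmax hz
      obtain ⟨a, -, -, ha, -, -, hha, -⟩ := hhigh h (hS h (by simp))
      obtain ⟨A, c, B, hsplit, hB, hhc⟩ := List.exists_last_split (H.Adj h) (h :: t)
        ⟨a, hmax h (by simp) a ha hha, hha⟩
      have hAc : h :: t = (A ++ [c]) ++ B := by simp [hsplit]
      obtain ⟨t', ht'⟩ : ∃ t', A ++ [c] = h :: t' := by
        cases A with
        | nil =>
          simp at hsplit
          rw [hsplit.1] at hhc
          exact absurd rfl hhc.ne
        | cons b A =>
          simp at hsplit
          exact ⟨A ++ [c], by simp [hsplit.1]⟩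
      rw [hAc] at hc hn hz hmax hS
      refine h3.properOn_of_cycle ih ht' (q := c) (by simp) hhc (List.isChain_append.1 hc).1
        (List.nodup_append.1 hn).1 ⟨fun w hw => hS w (List.mem_append_left _ hw), fun hle => ?_⟩ ?_
      · exact hz (List.mem_append_left _ (hle hzS))
      · intro w hw hhw
        have := hmax h (by simp [ht']) w hw hhw
        rcases List.mem_append.1 this with h' | h'
        · exact h'
        · exact absurd hhw (hB w h')
  rcases S.eq_empty_or_nonempty with rfl | ⟨v, hv⟩
  · exact ⟨fun _ => 0, by simp [ProperOn]⟩
  obtain ⟨a, b, c, ha, hb, hc, hva, hvb, hvc, hab, hac, hbc⟩ := hhigh v hv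
  by_cases h1 : H.Adj a b
  · by_cases h2 : H.Adj a c
    · exact claim v b c a hv hb hc ha hvb hvc hva hbc hab.symm hac.symm (h4 v a b c hva hvb hvc h1 h2)
    · exact claim v a c b hv ha hc hb hva hvc hvb hac hab hbc.symm h2
  · exact claim v a b c hv ha hb hc hva hvb hvc hab hac hbc h1

end Brooks

section Copies

variable {V : Type*} {G : SimpleGraph V} {f : V → Fin 3}

/-- No three vertices are pairwise adjacent. -/
def TriangleFree (G : SimpleGraph V) : Prop :=
  ∀ a b c, G.Adj a b → G.Adj b c → G.Adj a c → False

/-- The path `v₁ v₂ v₃ v₄` and the common neighbors `u₁`, `u₂` of its ends form a copy of `L₀`. -/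
structure IsL0 (G : SimpleGraph V) (v₁ v₂ v₃ v₄ u₁ u₂ : V) : Prop where
  adj₁₂ : G.Adj v₁ v₂
  adj₂₃ : G.Adj v₂ v₃
  adj₃₄ : G.Adj v₃ v₄
  adj_u₁₁ : G.Adj u₁ v₁
  adj_u₁₄ : G.Adj u₁ v₄
  adj_u₂₁ : G.Adj u₂ v₁
  adj_u₂₄ : G.Adj u₂ v₄
  ne : u₁ ≠ u₂

/-- A copy of `L₀` that is rainbow for `f`. -/
structure IsRainbowL0 (G : SimpleGraph V) (f : V → Fin 3) (v₁ v₂ v₃ v₄ u₁ u₂ : V) : Prop where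
  isL0 : IsL0 G v₁ v₂ v₃ v₄ u₁ u₂
  color_u : f u₁ = f u₂
  color₁₃ : f v₁ = f v₃
  color₂₄ : f v₂ = f v₄

/-- A proper coloring, as a plain function. -/
def IsProper (G : SimpleGraph V) (f : V → Fin 3) : Prop := ∀ x y, G.Adj x y → f x ≠ f y

variable {v₁ v₂ v₃ v₄ u₁ u₂ : V}

namespace IsL0

lemma swap (h : IsL0 G v₁ v₂ v₃ v₄ u₁ u₂) : IsL0 G v₁ v₂ v₃ v₄ u₂ u₁ :=
  ⟨h.1, h.2, h.3, h.6, h.7, h.4, h.5, h.8.symm⟩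

lemma reverse (h : IsL0 G v₁ v₂ v₃ v₄ u₁ u₂) : IsL0 G v₄ v₃ v₂ v₁ u₁ u₂ :=
  ⟨h.3.symm, h.2.symm, h.1.symm, h.5, h.4, h.7, h.6, h.8⟩

lemma nodup (h : IsL0 G v₁ v₂ v₃ v₄ u₁ u₂) (tf : TriangleFree G) :
    [v₁, v₂, v₃, v₄, u₁, u₂].Nodup := by
  obtain ⟨h1, h2, h3, h4, h5, h6, h7, h8⟩ := h
  have a1 : v₁ ≠ v₃ := by rintro rfl; exact tf _ _ _ h3 h5.symm h4.symm
  have a2 : v₁ ≠ v₄ := by rintro rfl; exact tf _ _ _ h1 h2 h3.symm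
  have a3 : v₂ ≠ v₄ := by rintro rfl; exact tf _ _ _ h1 h5.symm h4.symm
  have a4 : v₂ ≠ u₁ := by rintro rfl; exact tf _ _ _ h2 h3 h5
  have a5 : v₂ ≠ u₂ := by rintro rfl; exact tf _ _ _ h2 h3 h7
  have a6 : v₃ ≠ u₁ := by rintro rfl; exact tf _ _ _ h1 h2 h4.symm
  have a7 : v₃ ≠ u₂ := by rintro rfl; exact tf _ _ _ h1 h2 h6.symm
  simp [h1.ne, h2.ne, h3.ne, h4.ne', h5.ne', h6.ne', h7.ne', h8, a1, a2, a3, a4, a5, a6, a7]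

lemma eq_of_adj (h : IsL0 G v₁ v₂ v₃ v₄ u₁ u₂) (tf : TriangleFree G) (h3 : DegLeThree G) {z : V}
    (hz : G.Adj v₁ z) : z = u₁ ∨ z = u₂ ∨ z = v₂ := by
  have := h.nodup tf
  simp at this
  exact h3.eq_of_adj h.adj_u₁₁.symm h.adj_u₂₁.symm h.adj₁₂ h.ne (by tauto) (by tauto) hz

end IsL0

namespace IsRainbowL0

lemma swap (h : IsRainbowL0 G f v₁ v₂ v₃ v₄ u₁ u₂) : IsRainbowL0 G f v₁ v₂ v₃ v₄ u₂ u₁ :=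
  ⟨h.1.swap, h.2.symm, h.3, h.4⟩

lemma reverse (h : IsRainbowL0 G f v₁ v₂ v₃ v₄ u₁ u₂) : IsRainbowL0 G f v₄ v₃ v₂ v₁ u₁ u₂ :=
  ⟨h.1.reverse, h.2, h.4.symm, h.3.symm⟩

/-- By symmetry, a given vertex of a rainbow copy of `L₀` is the first or second vertex
of its path or the first common neighbor of the ends of the path. -/
lemma wlog_mem (h : IsRainbowL0 G f v₁ v₂ v₃ v₄ u₁ u₂) {z : V}
    (hz : z ∈ ({v₁, v₂, v₃, v₄, u₁, u₂} : Set V)) :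
    ∃ w₁ w₂ w₃ w₄ t₁ t₂, IsRainbowL0 G f w₁ w₂ w₃ w₄ t₁ t₂ ∧
      ({w₁, w₂, w₃, w₄, t₁, t₂} : Set V) = {v₁, v₂, v₃, v₄, u₁, u₂} ∧
      (z = w₁ ∨ z = w₂ ∨ z = t₁) := by
  simp only [Set.mem_insert_iff, Set.mem_singleton_iff] at hz
  rcases hz with hz | hz | hz | hz | hz | hz
  · exact ⟨_, _, _, _, _, _, h, rfl, by tauto⟩
  · exact ⟨_, _, _, _, _, _, h, rfl, by tauto⟩
  · exact ⟨_, _, _, _, _, _, h.reverse, by ext; simp; tauto, by tauto⟩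
  · exact ⟨_, _, _, _, _, _, h.reverse, by ext; simp; tauto, by tauto⟩
  · exact ⟨_, _, _, _, _, _, h, rfl, by tauto⟩
  · exact ⟨_, _, _, _, _, _, h.swap, by ext; simp; tauto, by tauto⟩

lemma congr {g : V → Fin 3} (h : IsRainbowL0 G f v₁ v₂ v₃ v₄ u₁ u₂)
    (hfg : ∀ z ∈ ({v₁, v₂, v₃, v₄, u₁, u₂} : Set V), f z = g z) :
    IsRainbowL0 G g v₁ v₂ v₃ v₄ u₁ u₂ := by
  simp only [Set.mem_insert_iff, Set.mem_singleton_iff, forall_eq_or_imp, forall_eq] at hfg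
  obtain ⟨a, b, c, d, e, e'⟩ := hfg
  exact ⟨h.1, by rw [← e, ← e', h.2], by rw [← a, ← c, h.3], by rw [← b, ← d, h.4]⟩

end IsRainbowL0

/-! ### Pairings of opposite vertices of 4-cycles -/

/-- An involution that interchanges, in some 4-cycles of copies of `L₀`, opposite vertices,
and fixes all other vertices. -/
structure IsPairing (G : SimpleGraph V) (σ : V → V) : Prop where
  involutive : ∀ x, σ (σ x) = x
  exists_isL0 : ∀ x, σ x ≠ x → ∃ v₁ v₂ v₃ v₄ u₁ u₂, IsL0 G v₁ v₂ v₃ v₄ u₁ u₂ ∧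
    σ v₁ = v₄ ∧ σ u₁ = u₂ ∧ (x = v₁ ∨ x = u₁)

lemma exists_maximal_pairing [Finite V] (tf : TriangleFree G) :
    ∃ σ : V → V, IsPairing G σ ∧ ∀ v₁ v₂ v₃ v₄ u₁ u₂, IsL0 G v₁ v₂ v₃ v₄ u₁ u₂ →
      σ v₁ ≠ v₁ ∨ σ v₄ ≠ v₄ ∨ σ u₁ ≠ u₁ ∨ σ u₂ ≠ u₂ := by
  classical
  have : Nonempty {σ : V → V // IsPairing G σ} :=
    ⟨id, fun _ => rfl, fun x hx => absurd rfl hx⟩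
  obtain ⟨⟨σ, hσ⟩, hmax⟩ :=
    Finite.exists_max fun σ : {σ : V → V // IsPairing G σ} => {x | σ.1 x ≠ x}.ncard
  refine ⟨σ, hσ, fun v₁ v₂ v₃ v₄ u₁ u₂ h => ?_⟩
  by_contra! hfix
  obtain ⟨f1, f4, g1, g2⟩ := hfix
  have hnd := h.nodup tf
  simp only [List.nodup_cons, List.mem_cons, List.not_mem_nil] at hnd
  have hinv := hσ.involutive
  let τ : V → V := fun x =>
    if x = v₁ then v₄ else if x = v₄ then v₁ else if x = u₁ then u₂ else if x = u₂ then u₁ else σ x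
  have t1 : τ v₁ = v₄ := by simp [τ]
  have t4 : τ v₄ = v₁ := by simp only [τ]; grind
  have s1 : τ u₁ = u₂ := by simp only [τ]; grind
  have s2 : τ u₂ = u₁ := by simp only [τ]; grind
  have t0 : ∀ x, x ≠ v₁ → x ≠ v₄ → x ≠ u₁ → x ≠ u₂ → τ x = σ x := by
    intro x; simp only [τ]; grind
  have hτ : IsPairing G τ := by
    refine ⟨fun x => ?_, fun x hx => ?_⟩
    · by_cases h1 : x = v₁
      · rw [h1, t1, t4]
      by_cases h4 : x = v₄
      · rw [h4, t4, t1]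
      by_cases h5 : x = u₁
      · rw [h5, s1, s2]
      by_cases h6 : x = u₂
      · rw [h6, s2, s1]
      have := hinv x
      rw [t0 x h1 h4 h5 h6, t0 (σ x), this] <;> grind
    · by_cases h1 : x = v₁
      · exact ⟨_, _, _, _, _, _, h, t1, s1, by tauto⟩
      by_cases h4 : x = v₄
      · exact ⟨_, _, _, _, _, _, h.reverse, t4, s1, by tauto⟩
      by_cases h5 : x = u₁
      · exact ⟨_, _, _, _, _, _, h, t1, s1, by tauto⟩
      by_cases h6 : x = u₂
      · exact ⟨_, _, _, _, _, _, h.swap, t1, s2, by tauto⟩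
      rw [t0 x h1 h4 h5 h6] at hx
      obtain ⟨a1, a2, a3, a4, b1, b2, hL, ha, hb, hx'⟩ := hσ.exists_isL0 x hx
      have hnd' := hL.nodup tf
      simp only [List.nodup_cons, List.mem_cons, List.not_mem_nil] at hnd'
      exact ⟨a1, a2, a3, a4, b1, b2, hL, by rw [t0] <;> grind, by rw [t0] <;> grind, hx'⟩
  have hlt : {x | σ x ≠ x}.ncard < {x | τ x ≠ x}.ncard := by
    refine Set.ncard_lt_ncard ⟨fun x hx => ?_, fun hle => ?_⟩ (Set.toFinite _)
    · have : σ x ≠ x := hx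
      change τ x ≠ x
      rw [t0 x] <;> grind
    · exact (hle (show τ v₁ ≠ v₁ by grind)) f1
  exact absurd (hmax ⟨τ, hτ⟩) (not_le.2 hlt)

/-- The equivalence relation whose classes are the orbits of a pairing. -/
def IsPairing.setoid {σ : V → V} (hσ : IsPairing G σ) : Setoid V where
  r x y := y = x ∨ y = σ x
  iseqv :=
    { refl := fun x => Or.inl rfl
      symm := by
        rintro x y (rfl | rfl)
        · exact Or.inl rfl
        · exact Or.inr (hσ.involutive x).symm
      trans := by
        rintro x y z (rfl | rfl) (rfl | rfl)
        · exact Or.inl rfl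
        · exact Or.inr rfl
        · exact Or.inr rfl
        · exact Or.inl (hσ.involutive x) }

/-- The graph that arises from `G` by identifying paired vertices. -/
def IsPairing.contract {σ : V → V} (hσ : IsPairing G σ) : SimpleGraph (Quotient hσ.setoid) :=
  G.map (Quotient.mk hσ.setoid)

section Contract

variable {σ : V → V} (hσ : IsPairing G σ)

lemma IsPairing.mk_eq {x y : V} :
    Quotient.mk hσ.setoid x = Quotient.mk hσ.setoid y ↔ y = x ∨ y = σ x :=
  Quotient.eq (r := hσ.setoid)

lemma IsPairing.contract_adj {x : V} {Y : Quotient hσ.setoid} :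
    hσ.contract.Adj (Quotient.mk hσ.setoid x) Y ↔ Quotient.mk hσ.setoid x ≠ Y ∧
      ∃ a b, G.Adj a b ∧ (a = x ∨ a = σ x) ∧ Quotient.mk hσ.setoid b = Y := by
  rw [IsPairing.contract, SimpleGraph.map_adj']
  refine and_congr_right fun _ => exists_congr fun a => exists_congr fun b => ?_
  rw [eq_comm (a := Quotient.mk hσ.setoid a), hσ.mk_eq]

lemma IsPairing.not_adj {σ : V → V} (hσ : IsPairing G σ) (tf : TriangleFree G) {x y : V} (h : G.Adj x y) : y ≠ σ x := by
  rintro rfl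
  obtain ⟨v₁, v₂, v₃, v₄, u₁, u₂, hL, h1, h2, rfl | rfl⟩ := hσ.exists_isL0 x h.ne'
  · rw [h1] at h; exact tf _ _ _ h hL.adj_u₁₄.symm hL.adj_u₁₁.symm
  · rw [h2] at h; exact tf _ _ _ h hL.adj_u₂₁ hL.adj_u₁₁

lemma IsPairing.contract_adj_v (tf : TriangleFree G) (h3 : DegLeThree G)
    (hL : IsL0 G v₁ v₂ v₃ v₄ u₁ u₂) (h1 : σ v₁ = v₄) (h2 : σ u₁ = u₂) {Y : Quotient hσ.setoid}
    (h : hσ.contract.Adj (Quotient.mk hσ.setoid v₁) Y) :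
    Y = Quotient.mk hσ.setoid u₁ ∨ Y = Quotient.mk hσ.setoid v₂ ∨ Y = Quotient.mk hσ.setoid v₃ := by
  obtain ⟨-, a, b, hab, ha, rfl⟩ := hσ.contract_adj.1 h
  have hu : Quotient.mk hσ.setoid u₂ = Quotient.mk hσ.setoid u₁ :=
    ((hσ.mk_eq).2 (Or.inr h2.symm)).symm
  rw [h1] at ha
  rcases ha with rfl | rfl
  · rcases hL.eq_of_adj tf h3 hab with rfl | rfl | rfl <;> tauto
  · rcases hL.reverse.eq_of_adj tf h3 hab with rfl | rfl | rfl <;> tauto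

lemma DegLeThree.third (h3 : DegLeThree G) {x a b : V} (ha : G.Adj x a) (hb : G.Adj x b)
    (hab : a ≠ b) : ∃ c, ∀ z, G.Adj x z → z = a ∨ z = b ∨ z = c := by
  obtain ⟨p, q, r, h⟩ := h3 x
  have h1 := h a ha
  have h2 := h b hb
  by_cases hc : ∃ c, G.Adj x c ∧ c ≠ a ∧ c ≠ b
  · obtain ⟨c, hc, hca, hcb⟩ := hc
    exact ⟨c, fun z hz => h3.eq_of_adj ha hb hc hab hca.symm hcb.symm hz⟩
  · push Not at hc
    exact ⟨a, fun z hz => by have := hc z hz; tauto⟩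

lemma IsPairing.contract_adj_u (tf : TriangleFree G) (h3 : DegLeThree G)
    (hL : IsL0 G v₁ v₂ v₃ v₄ u₁ u₂) (h1 : σ v₁ = v₄) (h2 : σ u₁ = u₂) :
    ∃ A B, ∀ Y, hσ.contract.Adj (Quotient.mk hσ.setoid u₁) Y →
      Y = Quotient.mk hσ.setoid v₁ ∨ Y = A ∨ Y = B := by
  have hnd := hL.nodup tf
  simp only [List.nodup_cons, List.mem_cons, List.not_mem_nil] at hnd
  have hv : v₁ ≠ v₄ := by tauto
  obtain ⟨w, hw⟩ := h3.third hL.adj_u₁₁ hL.adj_u₁₄ hv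
  obtain ⟨w', hw'⟩ := h3.third hL.adj_u₂₁ hL.adj_u₂₄ hv
  have hv4 : Quotient.mk hσ.setoid v₄ = Quotient.mk hσ.setoid v₁ :=
    ((hσ.mk_eq).2 (Or.inr h1.symm)).symm
  refine ⟨Quotient.mk _ w, Quotient.mk _ w', fun Y h => ?_⟩
  obtain ⟨-, a, b, hab, ha, rfl⟩ := hσ.contract_adj.1 h
  rw [h2] at ha
  rcases ha with rfl | rfl
  · rcases hw b hab with rfl | rfl | rfl <;> tauto
  · rcases hw' b hab with rfl | rfl | rfl <;> tauto

lemma IsPairing.contract_degLeThree (tf : TriangleFree G) (h3 : DegLeThree G) :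
    DegLeThree hσ.contract := by
  intro X
  obtain ⟨x, rfl⟩ := Quotient.exists_rep X
  by_cases hx : σ x = x
  · obtain ⟨a, b, c, h⟩ := h3 x
    refine ⟨Quotient.mk _ a, Quotient.mk _ b, Quotient.mk _ c, fun Y hY => ?_⟩
    obtain ⟨-, p, q, hpq, hp, rfl⟩ := hσ.contract_adj.1 hY
    rw [hx, or_self] at hp
    subst hp
    rcases h q hpq with rfl | rfl | rfl <;> tauto
  · obtain ⟨v₁, v₂, v₃, v₄, u₁, u₂, hL, h1, h2, rfl | rfl⟩ := hσ.exists_isL0 x hx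
    · exact ⟨_, _, _, fun Y hY => hσ.contract_adj_v tf h3 hL h1 h2 hY⟩
    · obtain ⟨A, B, h⟩ := hσ.contract_adj_u tf h3 hL h1 h2
      exact ⟨_, A, B, h⟩

lemma isContained_R5 (hL : IsL0 G v₁ v₂ v₃ v₄ u₁ u₂) {w y : V} (h1 : G.Adj w u₁)
    (h2 : G.Adj w v₃) (h3 : G.Adj y u₂) (h4 : G.Adj y v₂) (h5 : G.Adj y w)
    (hnd : [v₁, v₂, v₃, v₄, u₁, u₂, w, y].Nodup) : R5.IsContained G := by
  refine ⟨⟨⟨![v₁, v₂, v₃, v₄, u₁, u₂, w, y], ?_⟩, ?_⟩⟩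
  · intro i j hij
    simp only [R5, SimpleGraph.fromEdgeSet_adj, Set.mem_insert_iff, Set.mem_singleton_iff,
      Sym2.eq_iff] at hij
    obtain ⟨hij, -⟩ := hij
    obtain ⟨a1, a2, a3, a4, a5, a6, a7, -⟩ := hL
    rcases hij with h | h | h | h | h | h | h | h | h | h | h | h <;>
      rcases h with ⟨rfl, rfl⟩ | ⟨rfl, rfl⟩ <;> simp <;>
      first | assumption | (apply SimpleGraph.Adj.symm; assumption)
  · intro i j hij
    have := List.nodup_iff_injective_get.1 hnd
    apply this
    revert hij
    fin_cases i <;> fin_cases j <;> simp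

lemma IsPairing.not_clique_of_v (tf : TriangleFree G) (h3 : DegLeThree G) (hR : R5.Free G)
    (hL : IsL0 G v₁ v₂ v₃ v₄ u₁ u₂) (h1 : σ v₁ = v₄) (h2 : σ u₁ = u₂)
    {A B C : Quotient hσ.setoid}
    (hA : hσ.contract.Adj (Quotient.mk hσ.setoid v₁) A)
    (hB : hσ.contract.Adj (Quotient.mk hσ.setoid v₁) B)
    (hC : hσ.contract.Adj (Quotient.mk hσ.setoid v₁) C)
    (hAB : hσ.contract.Adj A B) (hAC : hσ.contract.Adj A C) (hBC : hσ.contract.Adj B C) :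
    False := by
  have hA' := hσ.contract_adj_v tf h3 hL h1 h2 hA
  have hB' := hσ.contract_adj_v tf h3 hL h1 h2 hB
  have hC' := hσ.contract_adj_v tf h3 hL h1 h2 hC
  have key : hσ.contract.Adj (Quotient.mk hσ.setoid u₁) (Quotient.mk hσ.setoid v₂) ∧
      hσ.contract.Adj (Quotient.mk hσ.setoid u₁) (Quotient.mk hσ.setoid v₃) := by
    have n1 := hAB.ne
    have n2 := hAC.ne
    have n3 := hBC.ne
    have := hAB.symm
    have := hAC.symm
    have := hBC.symm
    rcases hA' with rfl | rfl | rfl <;> rcases hB' with rfl | rfl | rfl <;>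
      rcases hC' with rfl | rfl | rfl <;> tauto
  clear hA hB hC hA' hB' hC' hAB hAC hBC
  have hinv := hσ.involutive
  have step : ∀ v, (∃ a, G.Adj v a ∧ (a = v₁ ∨ a = v₄)) →
      hσ.contract.Adj (Quotient.mk hσ.setoid u₁) (Quotient.mk hσ.setoid v) →
      σ v ≠ v ∧ (G.Adj u₁ (σ v) ∨ G.Adj u₂ (σ v)) := by
    rintro v ⟨c, hvc, hc⟩ h
    obtain ⟨-, a, b, hab, ha, hb⟩ := hσ.contract_adj.1 h
    have hb' := (hσ.mk_eq).1 hb.symm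
    rw [h2] at ha
    have hva : ¬ G.Adj a v := by
      intro hav
      rcases ha with rfl | rfl <;> rcases hc with rfl | rfl
      · exact tf _ _ _ hav hvc hL.adj_u₁₁
      · exact tf _ _ _ hav hvc hL.adj_u₁₄
      · exact tf _ _ _ hav hvc hL.adj_u₂₁
      · exact tf _ _ _ hav hvc hL.adj_u₂₄
    rcases hb' with rfl | rfl
    · exact absurd hab hva
    · refine ⟨fun hv => hva (by rwa [hv] at hab), ?_⟩
      rcases ha with rfl | rfl <;> tauto
  obtain ⟨n2, a2⟩ := step v₂ ⟨v₁, hL.adj₁₂.symm, Or.inl rfl⟩ key.1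
  obtain ⟨n3, a3⟩ := step v₃ ⟨v₄, hL.adj₃₄, Or.inr rfl⟩ key.2
  clear step key
  have hnd := hL.nodup tf
  simp only [List.nodup_cons, List.mem_cons, List.not_mem_nil, or_false, not_or, not_false_eq_true,
    List.nodup_nil, and_true] at hnd
  obtain ⟨⟨i12, i13, i14, i1u, i1t⟩, ⟨i23, i24, i2u, i2t⟩, ⟨i34, i3u, i3t⟩, ⟨i4u, i4t⟩, iut⟩ := hnd
  obtain ⟨p, hp, hp', hpp⟩ : ∃ p, G.Adj v₂ p ∧ G.Adj (σ v₂) p ∧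
      (G.Adj v₂ (σ p) ∧ G.Adj (σ v₂) (σ p) ∧ σ p ≠ p) := by
    obtain ⟨w₁, w₂, w₃, w₄, t₁, t₂, hL', e1, e2, hx | hx⟩ := hσ.exists_isL0 v₂ n2
    · exact ⟨t₁, by rw [hx]; exact hL'.adj_u₁₁.symm, by rw [hx, e1]; exact hL'.adj_u₁₄.symm,
        by rw [hx, e2]; exact hL'.adj_u₂₁.symm, by rw [hx, e1, e2]; exact hL'.adj_u₂₄.symm,
        by rw [e2]; exact hL'.ne.symm⟩
    · have hn := hL'.nodup tf
      simp only [List.nodup_cons, List.mem_cons, not_or] at hn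
      exact ⟨w₁, by rw [hx]; exact hL'.adj_u₁₁, by rw [hx, e2]; exact hL'.adj_u₂₁,
        by rw [hx, e1]; exact hL'.adj_u₁₄, by rw [hx, e1, e2]; exact hL'.adj_u₂₄,
        by rw [e1]; exact Ne.symm hn.1.2.2.1⟩
  obtain ⟨hp2, hp3, hp4⟩ := hpp
  have hv4 : ¬ G.Adj v₂ v₄ := fun h => tf _ _ _ hL.adj₂₃ hL.adj₃₄ h
  have hb : G.Adj v₂ (σ v₃) ∧ G.Adj (σ v₂) v₃ ∧ G.Adj (σ v₂) (σ v₃) := by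
    obtain ⟨c, hc⟩ := h3.third hL.adj₁₂.symm hL.adj₂₃ i13
    have q1 := hc p hp
    have q2 := hc (σ p) hp2
    have e1 := hinv v₁
    have e2 := hinv p
    have : p = v₃ ∨ σ p = v₃ := by grind
    rcases this with rfl | h
    · exact ⟨hp2, hp', hp3⟩
    · rw [h] at e2 hp3; rw [e2]; exact ⟨hp, hp3, hp'⟩
  obtain ⟨b1, b2, b3⟩ := hb
  have q : ∀ v z, σ v = z → v = σ z := by rintro v _ rfl; exact (hinv v).symm
  have h1' : σ v₄ = v₁ := (q _ _ h1).symm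
  have h2' : σ u₂ = u₁ := (q _ _ h2).symm
  have c : ∀ v, v ≠ v₁ → v ≠ v₄ → v ≠ u₁ → v ≠ u₂ →
      v₁ ≠ σ v ∧ v₄ ≠ σ v ∧ u₁ ≠ σ v ∧ u₂ ≠ σ v := by
    intro v g1 g2 g3 g4
    refine ⟨fun h => g2 ?_, fun h => g1 ?_, fun h => g4 ?_, fun h => g3 ?_⟩
    · rw [q _ _ h.symm, h1]
    · rw [q _ _ h.symm, h1']
    · rw [q _ _ h.symm, h2]
    · rw [q _ _ h.symm, h2']
  obtain ⟨m1, m2, m3, m4⟩ := c v₂ (Ne.symm i12) i24 i2u i2t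
  obtain ⟨k1, k2, k3, k4⟩ := c v₃ (Ne.symm i13) i34 i3u i3t
  have d1 := b1.ne
  have d2 := b2.ne'
  have d3 := b3.ne
  rcases a2 with a2 | a2 <;> rcases a3 with a3 | a3
  · exact tf _ _ _ a2 b3 a3
  · exact hR (isContained_R5 hL (w := σ v₂) (y := σ v₃) a2.symm b2 a3.symm b1.symm b3.symm (by
      simp only [List.nodup_cons, List.mem_cons, List.not_mem_nil, or_false, not_or,
        not_false_eq_true, List.nodup_nil, and_true]
      grind only))
  · exact hR (isContained_R5 hL.swap (w := σ v₂) (y := σ v₃) a2.symm b2 a3.symm b1.symm b3.symm (by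
      simp only [List.nodup_cons, List.mem_cons, List.not_mem_nil, or_false, not_or,
        not_false_eq_true, List.nodup_nil, and_true]
      grind only))
  · exact tf _ _ _ a2 b3 a3

lemma IsPairing.contract_not_clique (tf : TriangleFree G) (h3 : DegLeThree G) (hR : R5.Free G)
    (A B C D : Quotient hσ.setoid) (hAB : hσ.contract.Adj A B) (hAC : hσ.contract.Adj A C)
    (hAD : hσ.contract.Adj A D) (hBC : hσ.contract.Adj B C) (hBD : hσ.contract.Adj B D) :
    ¬ hσ.contract.Adj C D := by
  intro hCD
  have fixed : ∀ x B C D, hσ.contract.Adj (Quotient.mk hσ.setoid x) B →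
      hσ.contract.Adj (Quotient.mk hσ.setoid x) C → hσ.contract.Adj (Quotient.mk hσ.setoid x) D →
      hσ.contract.Adj B C → hσ.contract.Adj B D → hσ.contract.Adj C D → σ x = x := by
    intro x B C D hB hC hD hBC hBD hCD
    by_contra hx
    obtain ⟨v₁, v₂, v₃, v₄, u₁, u₂, hL, h1, h2, rfl | rfl⟩ := hσ.exists_isL0 x hx
    · exact hσ.not_clique_of_v tf h3 hR hL h1 h2 hB hC hD hBC hBD hCD
    · obtain ⟨P, Q, h⟩ := hσ.contract_adj_u tf h3 hL h1 h2
      have hB' := h B hB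
      have hC' := h C hC
      have hD' := h D hD
      have n1 := hBC.ne
      have n2 := hBD.ne
      have n3 := hCD.ne
      have : B = Quotient.mk hσ.setoid v₁ ∨ C = Quotient.mk hσ.setoid v₁ ∨
          D = Quotient.mk hσ.setoid v₁ := by grind
      rcases this with rfl | rfl | rfl
      · exact hσ.not_clique_of_v tf h3 hR hL h1 h2 hB.symm hBC hBD hC hD hCD
      · exact hσ.not_clique_of_v tf h3 hR hL h1 h2 hC.symm hBC.symm hCD hB hD hBD
      · exact hσ.not_clique_of_v tf h3 hR hL h1 h2 hD.symm hBD.symm hCD.symm hB hC hBC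
  obtain ⟨a, rfl⟩ := Quotient.exists_rep A
  obtain ⟨b, rfl⟩ := Quotient.exists_rep B
  obtain ⟨c, rfl⟩ := Quotient.exists_rep C
  have ha := fixed a _ _ _ hAB hAC hAD hBC hBD hCD
  have hb := fixed b _ _ _ hAB.symm hBC hBD hAC hAD hCD
  have hc := fixed c _ _ _ hAC.symm hBC.symm hCD hAB hAD hBD
  have lift : ∀ x y, σ x = x → σ y = y →
      hσ.contract.Adj (Quotient.mk hσ.setoid x) (Quotient.mk hσ.setoid y) → G.Adj x y := by
    intro x y hx hy h
    obtain ⟨-, p, q, hpq, hp, hq⟩ := hσ.contract_adj.1 h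
    have hq' := (hσ.mk_eq).1 hq.symm
    grind
  exact tf a b c (lift a b ha hb hAB) (lift b c hb hc hBC) (lift a c ha hc hAC)

/-- There is a proper coloring for which paired vertices have the same color. -/
lemma IsPairing.exists_coloring {σ : V → V} (hσ : IsPairing G σ) [Finite V] (tf : TriangleFree G) (h3 : DegLeThree G)
    (hR : R5.Free G) : ∃ f : V → Fin 3, IsProper G f ∧ ∀ x, f (σ x) = f x := by
  obtain ⟨g, hg⟩ := (hσ.contract_degLeThree tf h3).exists_coloring
    (hσ.contract_not_clique tf h3 hR)
  refine ⟨fun x => g (Quotient.mk _ x), fun x y hxy => hg _ _ ?_, fun x => ?_⟩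
  · rw [hσ.contract_adj]
    refine ⟨fun h => ?_, x, y, hxy, Or.inl rfl, rfl⟩
    rcases (hσ.mk_eq).1 h with h | h
    · exact hxy.ne h.symm
    · exact hσ.not_adj tf hxy h
  · exact congrArg g ((hσ.mk_eq).2 (Or.inr rfl)).symm

end Contract

end Copies

section NoRainbow

variable {V : Type*} {G : SimpleGraph V} {f g : V → Fin 3}

variable {v₁ v₂ v₃ v₄ u₁ u₂ w₁ w₂ w₃ w₄ t₁ t₂ : V}

namespace IsRainbowL0

lemma color₁₂_ne (h : IsRainbowL0 G f v₁ v₂ v₃ v₄ u₁ u₂) (hf : IsProper G f) : f v₁ ≠ f v₂ :=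
  hf _ _ h.1.adj₁₂

lemma color_u₁_ne (h : IsRainbowL0 G f v₁ v₂ v₃ v₄ u₁ u₂) (hf : IsProper G f) : f u₁ ≠ f v₁ :=
  hf _ _ h.1.adj_u₁₁

lemma color_u₂_ne (h : IsRainbowL0 G f v₁ v₂ v₃ v₄ u₁ u₂) (hf : IsProper G f) : f u₁ ≠ f v₂ := by
  rw [h.color₂₄]; exact hf _ _ h.1.adj_u₁₄

/-- Each vertex of a copy of `L₀` has two neighbors in that copy. -/
lemma exists_two_adj (h : IsRainbowL0 G f v₁ v₂ v₃ v₄ u₁ u₂) (tf : TriangleFree G) {z : V}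
    (hz : z ∈ ({v₁, v₂, v₃, v₄, u₁, u₂} : Set V)) :
    ∃ x ∈ ({v₁, v₂, v₃, v₄, u₁, u₂} : Set V), ∃ y ∈ ({v₁, v₂, v₃, v₄, u₁, u₂} : Set V),
      x ≠ y ∧ G.Adj z x ∧ G.Adj z y := by
  obtain ⟨w₁, w₂, w₃, w₄, t₁, t₂, h', hset, hz'⟩ := h.wlog_mem hz
  rw [← hset]
  have hnd := h'.1.nodup tf
  simp only [List.nodup_cons, List.mem_cons, not_or] at hnd
  rcases hz' with rfl | rfl | rfl
  · exact ⟨t₁, by simp, t₂, by simp, h'.1.ne, h'.1.adj_u₁₁.symm, h'.1.adj_u₂₁.symm⟩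
  · exact ⟨w₁, by simp, w₃, by simp, hnd.1.2.1, h'.1.adj₁₂.symm, h'.1.adj₂₃⟩
  · exact ⟨w₁, by simp, w₄, by simp, hnd.1.2.2.1, h'.1.adj_u₁₁, h'.1.adj_u₁₄⟩

/-- A vertex whose neighbors in a rainbow copy of `L₀` all have the same color
is an inner vertex of the path of the copy. -/
lemma exists_of_monochromatic (h : IsRainbowL0 G f v₁ v₂ v₃ v₄ u₁ u₂) (hf : IsProper G f) {z : V}
    (hz : z ∈ ({v₁, v₂, v₃, v₄, u₁, u₂} : Set V))
    (hmono : ∀ x ∈ ({v₁, v₂, v₃, v₄, u₁, u₂} : Set V), ∀ y ∈ ({v₁, v₂, v₃, v₄, u₁, u₂} : Set V),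
      G.Adj z x → G.Adj z y → f x = f y) :
    ∃ w₁ w₃ w₄ t₁ t₂, IsRainbowL0 G f w₁ z w₃ w₄ t₁ t₂ ∧
      ({w₁, z, w₃, w₄, t₁, t₂} : Set V) = {v₁, v₂, v₃, v₄, u₁, u₂} := by
  obtain ⟨w₁, w₂, w₃, w₄, t₁, t₂, h', hset, hz'⟩ := h.wlog_mem hz
  rw [← hset] at hmono
  rcases hz' with rfl | rfl | rfl
  · exact absurd (hmono t₁ (by simp) w₂ (by simp) h'.1.adj_u₁₁.symm h'.1.adj₁₂)
      (h'.color_u₂_ne hf)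
  · exact ⟨_, _, _, _, _, h', hset⟩
  · refine absurd (hmono w₁ (by simp) w₄ (by simp) h'.1.adj_u₁₁ h'.1.adj_u₁₄) ?_
    rw [← h'.color₂₄]; exact h'.color₁₂_ne hf

end IsRainbowL0

/-- The common neighbors `u`, `u'` of `a`, `b`, `c`, and a path `p m q` whose vertices
are adjacent to `b`, `a`, `c`: a copy of `R₄`. -/
structure IsR4 (G : SimpleGraph V) (a b c u u' m p q : V) : Prop where
  au : G.Adj a u
  au' : G.Adj a u'
  bu : G.Adj b u
  bu' : G.Adj b u'
  cu : G.Adj c u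
  cu' : G.Adj c u'
  am : G.Adj a m
  bp : G.Adj b p
  cq : G.Adj c q
  mp : G.Adj m p
  mq : G.Adj m q
  hab : a ≠ b
  hac : a ≠ c
  hbc : b ≠ c
  huu' : u ≠ u'
  hpq : p ≠ q

lemma IsR4.swap {a b c u u' m p q : V} (h : IsR4 G a b c u u' m p q) :
    IsR4 G a b c u' u m p q :=
  ⟨h.2, h.1, h.4, h.3, h.6, h.5, h.7, h.8, h.9, h.10, h.11, h.12, h.13, h.14, h.15.symm, h.16⟩

/-- The copy of `L₀` is part of a copy of `R₄`. -/
def ExtendsToR4 (G : SimpleGraph V) (v₁ v₂ v₃ v₄ u₁ u₂ : V) : Prop :=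
  ∃ c q, IsR4 G v₁ v₄ c u₁ u₂ v₂ v₃ q ∨ IsR4 G v₄ v₁ c u₁ u₂ v₃ v₂ q

lemma ExtendsToR4.swap (h : ExtendsToR4 G v₁ v₂ v₃ v₄ u₁ u₂) :
    ExtendsToR4 G v₁ v₂ v₃ v₄ u₂ u₁ := by
  obtain ⟨c, q, h | h⟩ := h
  · exact ⟨c, q, Or.inl h.swap⟩
  · exact ⟨c, q, Or.inr h.swap⟩

lemma ExtendsToR4.reverse (h : ExtendsToR4 G v₁ v₂ v₃ v₄ u₁ u₂) :
    ExtendsToR4 G v₄ v₃ v₂ v₁ u₁ u₂ := by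
  obtain ⟨c, q, h⟩ := h
  exact ⟨c, q, h.symm⟩

section Overlap

variable (tf : TriangleFree G) (h3 : DegLeThree G) (hf : IsProper G f)

include tf h3 hf

lemma IsRainbowL0.extends_of_v_eq_v (h' : IsRainbowL0 G f v₁ w₂ w₃ w₄ t₁ t₂)
    (h : IsL0 G v₁ v₂ v₃ v₄ u₁ u₂) (hv : f v₁ = f v₄) (hu : f u₁ = f u₂) :
    ExtendsToR4 G v₁ w₂ w₃ w₄ t₁ t₂ := by
  have e1 := h.eq_of_adj tf h3 h'.1.adj_u₁₁.symm
  have e2 := h.eq_of_adj tf h3 h'.1.adj_u₂₁.symm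
  have e3 := h.eq_of_adj tf h3 h'.1.adj₁₂
  have c1 := h'.color_u₂_ne hf
  have c2 := h'.color_u
  have c3 := h'.1.ne
  have hw : w₂ = v₂ ∧ (t₁ = u₁ ∧ t₂ = u₂ ∨ t₁ = u₂ ∧ t₂ = u₁) := by grind only
  have h4 : f v₁ ≠ f w₄ := by rw [← h'.color₂₄]; exact h'.color₁₂_ne hf
  have h44 : w₄ ≠ v₄ := by rintro rfl; exact h4 hv
  have h33 : w₃ ≠ v₃ := by
    rintro rfl
    exact hf _ _ h.adj₃₄ (h'.color₁₃.symm.trans hv)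
  have h14 : v₁ ≠ w₄ := by rintro rfl; exact h4 rfl
  have h14' : v₁ ≠ v₄ := by
    rintro rfl
    exact tf _ _ _ h.adj₁₂ h.adj₂₃ h.adj₃₄.symm
  obtain ⟨rfl, hw⟩ := hw
  refine ⟨v₄, v₃, Or.inl ⟨h'.1.adj_u₁₁.symm, h'.1.adj_u₂₁.symm, h'.1.adj_u₁₄.symm,
    h'.1.adj_u₂₄.symm, ?_, ?_, h.adj₁₂, h'.1.adj₃₄.symm, h.adj₃₄.symm, h'.1.adj₂₃, h.adj₂₃,
    h14, h14', h44, h'.1.ne, h33⟩⟩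
  · rcases hw with ⟨rfl, rfl⟩ | ⟨rfl, rfl⟩
    · exact h.adj_u₁₄.symm
    · exact h.adj_u₂₄.symm
  · rcases hw with ⟨rfl, rfl⟩ | ⟨rfl, rfl⟩
    · exact h.adj_u₂₄.symm
    · exact h.adj_u₁₄.symm

lemma IsRainbowL0.false_of_v_eq_u_aux (h' : IsRainbowL0 G f w₁ w₂ w₃ v₂ v₁ t₂)
    (h : IsL0 G v₁ v₂ v₃ v₄ u₁ u₂) (hv : f v₁ = f v₄) (hw : G.Adj w₁ v₄) : False := by
  rcases h'.1.eq_of_adj tf h3 hw with rfl | rfl | rfl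
  · exact tf _ _ _ h.adj₁₂ h.adj₂₃ h.adj₃₄.symm
  · exact tf _ _ _ h.adj₂₃ h.adj₃₄ h'.1.adj_u₂₄.symm
  · exact h'.color_u₂_ne hf hv

lemma IsRainbowL0.false_of_v_eq_u (h' : IsRainbowL0 G f w₁ w₂ w₃ w₄ v₁ t₂)
    (h : IsL0 G v₁ v₂ v₃ v₄ u₁ u₂) (hv : f v₁ = f v₄) (hu : f u₁ = f u₂) : False := by
  have e1 := h.eq_of_adj tf h3 h'.1.adj_u₁₁
  have e2 := h.eq_of_adj tf h3 h'.1.adj_u₁₄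
  have c1 : f w₁ ≠ f w₄ := by rw [← h'.color₂₄]; exact h'.color₁₂_ne hf
  have : (w₁ = v₂ ∧ (w₄ = u₁ ∨ w₄ = u₂)) ∨ (w₄ = v₂ ∧ (w₁ = u₁ ∨ w₁ = u₂)) := by grind only
  have a1 := h.adj_u₁₄
  have a2 := h.adj_u₂₄
  rcases this with ⟨rfl, hw⟩ | ⟨rfl, hw⟩
  · exact h'.reverse.false_of_v_eq_u_aux tf h3 hf h hv (by rcases hw with rfl | rfl <;> assumption)
  · exact h'.false_of_v_eq_u_aux tf h3 hf h hv (by rcases hw with rfl | rfl <;> assumption)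

lemma IsRainbowL0.false_of_u_eq_v (h' : IsRainbowL0 G f u₁ w₂ w₃ w₄ t₁ t₂)
    (h : IsL0 G v₁ v₂ v₃ v₄ u₁ u₂) (hv : f v₁ = f v₄) (hu : f u₁ = f u₂) : False := by
  have e1 := h'.1.eq_of_adj tf h3 h.adj_u₁₁
  have e2 := h'.1.eq_of_adj tf h3 h.adj_u₁₄
  have c1 := h'.color_u₂_ne hf
  have c2 := h'.color_u
  have h4 : f u₁ ≠ f w₄ := by rw [← h'.color₂₄]; exact h'.color₁₂_ne hf
  have hnd := h.nodup tf
  simp only [List.nodup_cons, List.mem_cons, not_or] at hnd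
  have n14 : v₁ ≠ v₄ := hnd.1.2.2.1
  have : (v₁ = t₁ ∨ v₁ = t₂) ∧ (v₄ = t₁ ∨ v₄ = t₂) := by grind only
  have a1 : G.Adj v₁ w₄ := by
    rcases this.1 with rfl | rfl
    exacts [h'.1.adj_u₁₄, h'.1.adj_u₂₄]
  have a2 : G.Adj v₄ w₄ := by
    rcases this.2 with rfl | rfl
    exacts [h'.1.adj_u₁₄, h'.1.adj_u₂₄]
  rcases h.eq_of_adj tf h3 a1 with rfl | rfl | rfl
  · exact h4 rfl
  · exact h4 hu
  · exact tf _ _ _ h.adj₂₃ h.adj₃₄ a2.symm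

lemma IsRainbowL0.extends_of_u_eq_u (h' : IsRainbowL0 G f w₁ w₂ w₃ w₄ u₁ t₂)
    (h : IsL0 G v₁ v₂ v₃ v₄ u₁ u₂) (hv : f v₁ = f v₄) (hu : f u₁ = f u₂) :
    ExtendsToR4 G w₁ w₂ w₃ w₄ u₁ t₂ := by
  have hnd := h.nodup tf
  simp only [List.nodup_cons, List.mem_cons, not_or] at hnd
  obtain ⟨z, hz⟩ := h3.third h.adj_u₁₁ h.adj_u₁₄ hnd.1.2.2.1
  have e1 := hz _ h'.1.adj_u₁₁
  have e2 := hz _ h'.1.adj_u₁₄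
  have c1 : f w₁ ≠ f w₄ := by rw [← h'.color₂₄]; exact h'.color₁₂_ne hf
  have : w₁ = v₁ ∨ w₁ = v₄ ∨ w₄ = v₁ ∨ w₄ = v₄ := by grind only
  rcases this with rfl | rfl | rfl | rfl
  · exact h'.extends_of_v_eq_v tf h3 hf h hv hu
  · exact h'.extends_of_v_eq_v tf h3 hf h.reverse hv.symm hu
  · exact (h'.reverse.extends_of_v_eq_v tf h3 hf h hv hu).reverse
  · exact (h'.reverse.extends_of_v_eq_v tf h3 hf h.reverse hv.symm hu).reverse

lemma IsRainbowL0.extendsToR4 {σ : V → V} (hσ : IsPairing G σ)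
    (hmax : ∀ v₁ v₂ v₃ v₄ u₁ u₂, IsL0 G v₁ v₂ v₃ v₄ u₁ u₂ →
      σ v₁ ≠ v₁ ∨ σ v₄ ≠ v₄ ∨ σ u₁ ≠ u₁ ∨ σ u₂ ≠ u₂) (hfσ : ∀ x, f (σ x) = f x)
    (h : IsRainbowL0 G f v₁ v₂ v₃ v₄ u₁ u₂) : ExtendsToR4 G v₁ v₂ v₃ v₄ u₁ u₂ := by
  have hv : ∀ {v₁ v₂ v₃ v₄ u₁ u₂}, IsRainbowL0 G f v₁ v₂ v₃ v₄ u₁ u₂ → σ v₁ ≠ v₁ →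
      ExtendsToR4 G v₁ v₂ v₃ v₄ u₁ u₂ := by
    intro v₁ v₂ v₃ v₄ u₁ u₂ h hx
    obtain ⟨w₁, w₂, w₃, w₄, t₁, t₂, hL, e1, e2, rfl | rfl⟩ := hσ.exists_isL0 _ hx
    · exact h.extends_of_v_eq_v tf h3 hf hL (by rw [← e1, hfσ]) (by rw [← e2, hfσ])
    · exact (h.false_of_u_eq_v tf h3 hf hL (by rw [← e1, hfσ]) (by rw [← e2, hfσ])).elim
  have hu : ∀ {v₁ v₂ v₃ v₄ u₁ u₂}, IsRainbowL0 G f v₁ v₂ v₃ v₄ u₁ u₂ → σ u₁ ≠ u₁ →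
      ExtendsToR4 G v₁ v₂ v₃ v₄ u₁ u₂ := by
    intro v₁ v₂ v₃ v₄ u₁ u₂ h hx
    obtain ⟨w₁, w₂, w₃, w₄, t₁, t₂, hL, e1, e2, rfl | rfl⟩ := hσ.exists_isL0 _ hx
    · exact (h.false_of_v_eq_u tf h3 hf hL (by rw [← e1, hfσ]) (by rw [← e2, hfσ])).elim
    · exact h.extends_of_u_eq_u tf h3 hf hL (by rw [← e1, hfσ]) (by rw [← e2, hfσ])
  rcases hmax _ _ _ _ _ _ h.1 with hx | hx | hx | hx
  · exact hv h hx
  · exact (hv h.reverse hx).reverse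
  · exact hu h hx
  · exact (hu h.swap hx).swap

end Overlap

/-! ### Recoloring a copy of `R₄` -/

section R4

variable {a b c u u' m p q : V}

/-- A coloring of the vertices of a copy of `R₄` such that no rainbow copy of `L₀`
meets that copy of `R₄`. -/
structure IsR4Coloring (g : V → Fin 3) (a b c u u' m p q : V) : Prop where
  ab : g a = g b
  ac : g a = g c
  uu' : g u = g u'
  pq : g p = g q
  up : g u = g p

lemma IsR4.eq_of_adj_u (h : IsR4 G a b c u u' m p q) (h3 : DegLeThree G) {z : V}
    (hz : G.Adj u z) : z = a ∨ z = b ∨ z = c :=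
  h3.eq_of_adj h.au.symm h.bu.symm h.cu.symm h.hab h.hac h.hbc hz

lemma IsR4.nodup (h : IsR4 G a b c u u' m p q) (tf : TriangleFree G) :
    [a, b, c, u, u', m, p, q].Nodup := by
  have n1 : a ≠ p := by rintro rfl; exact tf _ _ _ h.bp h.au h.bu
  have n2 : a ≠ q := by rintro rfl; exact tf _ _ _ h.cq h.au h.cu
  have n3 : b ≠ m := by rintro rfl; exact tf _ _ _ h.am h.bu h.au
  have n4 : c ≠ m := by rintro rfl; exact tf _ _ _ h.am h.cu h.au
  have n5 : b ≠ q := by rintro rfl; exact tf _ _ _ h.cq h.bu h.cu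
  have n6 : c ≠ p := by rintro rfl; exact tf _ _ _ h.bp h.cu h.bu
  have n7 : u ≠ m := by rintro rfl; exact tf _ _ _ h.bu h.mp h.bp
  have n8 : u' ≠ m := by rintro rfl; exact tf _ _ _ h.bu' h.mp h.bp
  have n9 : u ≠ p := by rintro rfl; exact tf _ _ _ h.am h.mp h.au
  have n10 : u' ≠ p := by rintro rfl; exact tf _ _ _ h.am h.mp h.au'
  have n11 : u ≠ q := by rintro rfl; exact tf _ _ _ h.am h.mq h.au
  have n12 : u' ≠ q := by rintro rfl; exact tf _ _ _ h.am h.mq h.au'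
  simp [n1, n2, n3, n4, n5, n6, n7, n8, n9, n10, n11, n12, h.au.ne, h.au'.ne, h.bu.ne, h.bu'.ne,
    h.cu.ne, h.cu'.ne, h.am.ne, h.bp.ne, h.cq.ne, h.mp.ne, h.mq.ne, h.hab, h.hac, h.hbc, h.huu',
    h.hpq]

lemma IsR4.not_mem_u (h : IsR4 G a b c u u' m p q) (h3 : DegLeThree G) (tf : TriangleFree G)
    (hg : IsProper G g) (hc : IsR4Coloring g a b c u u' m p q)
    (hr : IsRainbowL0 G g v₁ v₂ v₃ v₄ u₁ u₂) : u ∉ ({v₁, v₂, v₃, v₄, u₁, u₂} : Set V) := by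
  intro hu
  have hcol : ∀ x, G.Adj u x → g x = g a := by
    intro x hx
    rcases h.eq_of_adj_u h3 hx with rfl | rfl | rfl
    exacts [rfl, hc.ab.symm, hc.ac.symm]
  obtain ⟨w₁, w₃, w₄, t₁, t₂, hr', -⟩ := hr.exists_of_monochromatic hg hu
    fun x _ y _ hx hy => (hcol x hx).trans (hcol y hy).symm
  have hw : G.Adj w₁ u' := by
    rcases h.eq_of_adj_u h3 hr'.1.adj₁₂.symm with rfl | rfl | rfl
    exacts [h.au', h.bu', h.cu']
  have hcu := hc.uu'
  rcases hr'.1.eq_of_adj tf h3 hw with rfl | rfl | rfl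
  · exact hr'.color_u₂_ne hg hcu.symm
  · exact hr'.swap.color_u₂_ne hg hcu.symm
  · exact h.huu' rfl

lemma IsR4.not_mem (h : IsR4 G a b c u u' m p q) (h3 : DegLeThree G) (tf : TriangleFree G)
    (hg : IsProper G g) (hc : IsR4Coloring g a b c u u' m p q)
    (hr : IsRainbowL0 G g v₁ v₂ v₃ v₄ u₁ u₂) :
    ∀ z ∈ [a, b, c, u, u', m, p, q], z ∉ ({v₁, v₂, v₃, v₄, u₁, u₂} : Set V) := by
  have hnd := h.nodup tf
  simp only [List.nodup_cons, List.mem_cons, List.not_mem_nil, or_false, not_or] at hnd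
  obtain ⟨⟨-, -, nau, nau', nam, nap, naq⟩, ⟨-, nbu, nbu', nbm, nbp, nbq⟩,
    ⟨ncu, ncu', ncm, ncp, ncq⟩, ⟨-, num, nup, nuq⟩, ⟨num', nup', nuq'⟩, ⟨nmp, nmq⟩, -⟩ := hnd
  have mu := h.not_mem_u h3 tf hg hc hr
  have mu' := h.swap.not_mem_u h3 tf hg ⟨hc.ab, hc.ac, hc.uu'.symm, hc.pq, hc.uu'.symm.trans hc.up⟩ hr
  have one : ∀ z s t r, (∀ x, G.Adj z x → x = s ∨ x = t ∨ x = r) →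
      s ∉ ({v₁, v₂, v₃, v₄, u₁, u₂} : Set V) → t ∉ ({v₁, v₂, v₃, v₄, u₁, u₂} : Set V) →
      z ∉ ({v₁, v₂, v₃, v₄, u₁, u₂} : Set V) := by
    intro z s t r hz hs ht hzm
    obtain ⟨x, hx, y, hy, hxy, hzx, hzy⟩ := hr.exists_two_adj tf hzm
    have h1 : x = r := by
      rcases hz x hzx with rfl | rfl | rfl
      exacts [absurd hx hs, absurd hx ht, rfl]
    have h2 : y = r := by
      rcases hz y hzy with rfl | rfl | rfl
      exacts [absurd hy hs, absurd hy ht, rfl]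
    exact hxy (h1.trans h2.symm)
  have ma := one a u u' m (fun x => h3.eq_of_adj h.au h.au' h.am h.huu' num num') mu mu'
  have mb := one b u u' p (fun x => h3.eq_of_adj h.bu h.bu' h.bp h.huu' nup nup') mu mu'
  have mc := one c u u' q (fun x => h3.eq_of_adj h.cu h.cu' h.cq h.huu' nuq nuq') mu mu'
  have mm : m ∉ ({v₁, v₂, v₃, v₄, u₁, u₂} : Set V) := by
    intro hm
    have hN : ∀ x ∈ ({v₁, v₂, v₃, v₄, u₁, u₂} : Set V), G.Adj m x → x = p ∨ x = q := by
      intro x hx hmx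
      rcases h3.eq_of_adj h.am.symm h.mp h.mq nap naq h.hpq hmx with rfl | hx' | hx'
      exacts [absurd hx ma, Or.inl hx', Or.inr hx']
    have hcol : ∀ x ∈ ({v₁, v₂, v₃, v₄, u₁, u₂} : Set V), G.Adj m x → g x = g p := by
      intro x hx hmx
      rcases hN x hx hmx with rfl | rfl
      exacts [rfl, hc.pq.symm]
    obtain ⟨w₁, w₃, w₄, t₁, t₂, hr', hset⟩ := hr.exists_of_monochromatic hg hm
      fun x hx y hy hmx hmy => (hcol x hx hmx).trans (hcol y hy hmy).symm
    rw [← hset] at hN mb mc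
    simp only [Set.mem_insert_iff, Set.mem_singleton_iff, not_or] at mb mc
    rcases hN w₁ (by simp) hr'.1.adj₁₂.symm with rfl | rfl
    · rcases hr'.1.eq_of_adj tf h3 h.bp.symm with rfl | rfl | rfl <;> tauto
    · rcases hr'.1.eq_of_adj tf h3 h.cq.symm with rfl | rfl | rfl <;> tauto
  obtain ⟨x, hx⟩ := h3.third h.mp.symm h.bp.symm (Ne.symm nbm)
  obtain ⟨y, hy⟩ := h3.third h.mq.symm h.cq.symm (Ne.symm ncm)
  have mp := one p m b x hx mm mb
  have mq := one q m c y hy mm mc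
  intro z hz
  simp only [List.mem_cons, List.not_mem_nil, or_false] at hz
  rcases hz with rfl | rfl | rfl | rfl | rfl | rfl | rfl | rfl <;> assumption

lemma IsR4.exists_recoloring (h : IsR4 G a b c u u' m p q) (h3 : DegLeThree G)
    (tf : TriangleFree G) (hf : IsProper G f) :
    ∃ g, IsProper G g ∧ IsR4Coloring g a b c u u' m p q ∧
      ∀ z, z ∉ [a, b, c, u, u', m, p, q] → g z = f z := by
  classical
  have hnd := h.nodup tf
  simp only [List.nodup_cons, List.mem_cons, List.not_mem_nil, or_false, not_or] at hnd
  obtain ⟨⟨-, -, nau, nau', nam, nap, naq⟩, ⟨-, nbu, nbu', nbm, nbp, nbq⟩,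
    ⟨ncu, ncu', ncm, ncp, ncq⟩, ⟨-, num, nup, nuq⟩, ⟨num', nup', nuq'⟩, ⟨nmp, nmq⟩, -⟩ := hnd
  have hab := h.hab
  have hac := h.hac
  have hbc := h.hbc
  have huu' := h.huu'
  have hpq := h.hpq
  have Na : ∀ z, G.Adj a z → z = u ∨ z = u' ∨ z = m := fun z =>
    h3.eq_of_adj h.au h.au' h.am h.huu' num num'
  have Nb : ∀ z, G.Adj b z → z = u ∨ z = u' ∨ z = p := fun z =>
    h3.eq_of_adj h.bu h.bu' h.bp h.huu' nup nup'
  have Nc : ∀ z, G.Adj c z → z = u ∨ z = u' ∨ z = q := fun z =>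
    h3.eq_of_adj h.cu h.cu' h.cq h.huu' nuq nuq'
  have Nm : ∀ z, G.Adj m z → z = a ∨ z = p ∨ z = q := fun z =>
    h3.eq_of_adj h.am.symm h.mp h.mq nap naq h.hpq
  have Nu : ∀ z, G.Adj u z → z = a ∨ z = b ∨ z = c := fun z => h.eq_of_adj_u h3
  have Nu' : ∀ z, G.Adj u' z → z = a ∨ z = b ∨ z = c := fun z => h.swap.eq_of_adj_u h3
  obtain ⟨x, Np⟩ := h3.third h.mp.symm h.bp.symm (Ne.symm nbm)
  obtain ⟨y, Nq⟩ := h3.third h.mq.symm h.cq.symm (Ne.symm ncm)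
  obtain ⟨d, hdx, hdy⟩ := exists_color_ne (f x) (f y)
  obtain ⟨e, hed, -⟩ := exists_color_ne d d
  obtain ⟨k, hkd, hke⟩ := exists_color_ne d e
  let g : V → Fin 3 := fun z =>
    if z = a ∨ z = b ∨ z = c then k else if z = m then e
    else if z = u ∨ z = u' ∨ z = p ∨ z = q then d else f z
  have ga : g a = k := by simp [g]
  have gb : g b = k := by simp [g]
  have gc : g c = k := by simp [g]
  have gm : g m = e := by simp [g, (Ne.symm nam), (Ne.symm nbm), (Ne.symm ncm)]
  have gu : g u = d := by simp [g, (Ne.symm nau), (Ne.symm nbu), (Ne.symm ncu), num]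
  have gu' : g u' = d := by simp [g, (Ne.symm nau'), (Ne.symm nbu'), (Ne.symm ncu'), num']
  have gp : g p = d := by simp [g, (Ne.symm nap), (Ne.symm nbp), (Ne.symm ncp), (Ne.symm nmp)]
  have gq : g q = d := by simp [g, (Ne.symm naq), (Ne.symm nbq), (Ne.symm ncq), (Ne.symm nmq)]
  have g0 : ∀ z, z ∉ [a, b, c, u, u', m, p, q] → g z = f z := by
    intro z hz
    simp only [List.mem_cons, List.not_mem_nil, or_false, not_or] at hz
    obtain ⟨h1, h2, h3, h4, h5, h6, h7, h8⟩ := hz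
    simp [g, h1, h2, h3, h4, h5, h6, h7, h8]
  have key : ∀ z ∈ [a, b, c, u, u', m, p, q], ∀ z', G.Adj z z' → g z ≠ g z' := by
    intro z hz z' hzz'
    have hnot : ∀ {r s}, G.Adj r s → r = p ∨ r = q → s ≠ m → s ≠ b → s ≠ c →
        s ∉ [a, b, c, u, u', m, p, q] := by
      intro r s hrs hr hm hb hc hs
      have hpq' : ¬ G.Adj p q := fun h' => tf _ _ _ h.mp h' h.mq
      simp only [List.mem_cons, List.not_mem_nil, or_false] at hs
      have h1 := hrs.symm
      rcases hs with rfl | rfl | rfl | rfl | rfl | rfl | rfl | rfl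
      · have := Na _ h1; grind only
      · exact hb rfl
      · exact hc rfl
      · have := Nu _ h1; grind only
      · have := Nu' _ h1; grind only
      · exact hm rfl
      · rcases hr with rfl | rfl
        exacts [hrs.ne rfl, hpq' h1]
      · rcases hr with rfl | rfl
        exacts [hpq' hrs, hrs.ne rfl]
    simp only [List.mem_cons, List.not_mem_nil, or_false] at hz
    rcases hz with rfl | rfl | rfl | rfl | rfl | rfl | rfl | rfl
    · rcases Na _ hzz' with rfl | rfl | rfl <;> simp only [*] <;> grind only
    · rcases Nb _ hzz' with rfl | rfl | rfl <;> simp only [*] <;> grind only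
    · rcases Nc _ hzz' with rfl | rfl | rfl <;> simp only [*] <;> grind only
    · rcases Nu _ hzz' with rfl | rfl | rfl <;> simp only [*] <;> grind only
    · rcases Nu' _ hzz' with rfl | rfl | rfl <;> simp only [*] <;> grind only
    · rcases Nm _ hzz' with rfl | rfl | rfl <;> simp only [*] <;> grind only
    · by_cases h1 : z' = m
      · rw [h1, gp, gm]; exact hed.symm
      by_cases h2 : z' = b
      · rw [h2, gp, gb]; exact hkd.symm
      by_cases h3 : z' = c
      · rw [h3, gp, gc]; exact hkd.symm
      have hx : z' = x := by have := Np _ hzz'; tauto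
      rw [gp, g0 _ (hnot hzz' (Or.inl rfl) h1 h2 h3), hx]; exact hdx
    · by_cases h1 : z' = m
      · rw [h1, gq, gm]; exact hed.symm
      by_cases h2 : z' = b
      · rw [h2, gq, gb]; exact hkd.symm
      by_cases h3 : z' = c
      · rw [h3, gq, gc]; exact hkd.symm
      have hx : z' = y := by have := Nq _ hzz'; tauto
      rw [gq, g0 _ (hnot hzz' (Or.inr rfl) h1 h2 h3), hx]; exact hdy
  refine ⟨g, fun z z' hzz' => ?_, ⟨by rw [ga, gb], by rw [ga, gc], by rw [gu, gu'], by rw [gp, gq],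
    by rw [gu, gp]⟩, g0⟩
  by_cases hz : z ∈ [a, b, c, u, u', m, p, q]
  · exact key z hz z' hzz'
  by_cases hz' : z' ∈ [a, b, c, u, u', m, p, q]
  · exact (key z' hz' z hzz'.symm).symm
  rw [g0 z hz, g0 z' hz']
  exact hf z z' hzz'

end R4

/-- A proper coloring without rainbow copies of `L₀`. -/
def NoRainbow (G : SimpleGraph V) (f : V → Fin 3) : Prop :=
  ∀ v₁ v₂ v₃ v₄ u₁ u₂, ¬ IsRainbowL0 G f v₁ v₂ v₃ v₄ u₁ u₂

lemma exists_noRainbow_of_extendsToR4 [Finite V] (tf : TriangleFree G) (h3 : DegLeThree G)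
    (hf : IsProper G f)
    (h : ∀ v₁ v₂ v₃ v₄ u₁ u₂, IsRainbowL0 G f v₁ v₂ v₃ v₄ u₁ u₂ →
      ExtendsToR4 G v₁ v₂ v₃ v₄ u₁ u₂) : ∃ g, IsProper G g ∧ NoRainbow G g := by
  let B : (V → Fin 3) → Set (V × V × V × V × V × V) := fun f =>
    {t | IsRainbowL0 G f t.1 t.2.1 t.2.2.1 t.2.2.2.1 t.2.2.2.2.1 t.2.2.2.2.2}
  obtain ⟨S, hS⟩ : ∃ S, S = B f := ⟨_, rfl⟩
  induction S using WellFoundedLT.induction generalizing f with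
  | ind S ih => ?_
  by_cases hn : NoRainbow G f
  · exact ⟨f, hf, hn⟩
  simp only [NoRainbow, not_forall, not_not] at hn
  obtain ⟨v₁, v₂, v₃, v₄, u₁, u₂, hr⟩ := hn
  have main : ∀ {a b c u u' m p q}, IsR4 G a b c u u' m p q → (a = v₁ ∨ a = v₄) →
      ∃ g, IsProper G g ∧ NoRainbow G g := by
    intro a b c u u' m p q hR ha
    obtain ⟨g, hg, hgc, hgf⟩ := hR.exists_recoloring h3 tf hf
    have hsub : ∀ w₁ w₂ w₃ w₄ t₁ t₂, IsRainbowL0 G g w₁ w₂ w₃ w₄ t₁ t₂ →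
        IsRainbowL0 G f w₁ w₂ w₃ w₄ t₁ t₂ := by
      intro w₁ w₂ w₃ w₄ t₁ t₂ hr'
      exact hr'.congr fun z hz => hgf z fun hz' => hR.not_mem h3 tf hg hgc hr' z hz' hz
    refine ih (B g) ?_ hg (fun _ _ _ _ _ _ hr' => h _ _ _ _ _ _ (hsub _ _ _ _ _ _ hr')) rfl
    rw [hS]
    refine ⟨fun t ht => hsub _ _ _ _ _ _ ht, fun hle => ?_⟩
    have : IsRainbowL0 G g v₁ v₂ v₃ v₄ u₁ u₂ := hle (show (v₁, v₂, v₃, v₄, u₁, u₂) ∈ B f from hr)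
    refine hR.not_mem h3 tf hg hgc this a (by simp) ?_
    rcases ha with rfl | rfl <;> simp
  obtain ⟨c, q, hR | hR⟩ := h _ _ _ _ _ _ hr
  · exact main hR (Or.inl rfl)
  · exact main hR (Or.inr rfl)

theorem exists_noRainbow [Finite V] (tf : TriangleFree G) (h3 : DegLeThree G) (hR : R5.Free G) :
    ∃ f, IsProper G f ∧ NoRainbow G f := by
  obtain ⟨σ, hσ, hmax⟩ := exists_maximal_pairing tf
  obtain ⟨f, hf, hfσ⟩ := hσ.exists_coloring tf h3 hR
  exact exists_noRainbow_of_extendsToR4 tf h3 hf fun _ _ _ _ _ _ h =>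
    h.extendsToR4 tf h3 hf hσ hmax hfσ

end NoRainbow

section Minimal

variable {V : Type*} {G : SimpleGraph V} {f g : V → Fin 3}

/-- The vertex `x` has three neighbors, and they all have the same color. -/
def IsMono (G : SimpleGraph V) (f : V → Fin 3) (x : V) : Prop :=
  ∃ a b c, G.Adj x a ∧ G.Adj x b ∧ G.Adj x c ∧ a ≠ b ∧ a ≠ c ∧ b ≠ c ∧ f a = f b ∧ f a = f c

lemma IsMono.color_eq {x y z : V} (h : IsMono G f x) (h3 : DegLeThree G) (hy : G.Adj x y)
    (hz : G.Adj x z) : f y = f z := by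
  obtain ⟨a, b, c, ha, hb, hc, hab, hac, hbc, e1, e2⟩ := h
  rcases h3.eq_of_adj ha hb hc hab hac hbc hy with rfl | rfl | rfl <;>
    rcases h3.eq_of_adj ha hb hc hab hac hbc hz with rfl | rfl | rfl <;> simp_all

lemma IsMono.congr {x : V} (h : IsMono G f x) (hfg : ∀ y, G.Adj x y → f y = g y) :
    IsMono G g x := by
  obtain ⟨a, b, c, ha, hb, hc, hab, hac, hbc, e1, e2⟩ := h
  exact ⟨a, b, c, ha, hb, hc, hab, hac, hbc, by rw [← hfg a ha, ← hfg b hb, e1],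
    by rw [← hfg a ha, ← hfg c hc, e2]⟩

/-- A proper coloring without rainbow copies of `L₀` and with an inclusion-minimal set of
vertices with monochromatic neighborhoods of size three. -/
structure IsMinimalColoring (G : SimpleGraph V) (f : V → Fin 3) : Prop where
  proper : IsProper G f
  noRainbow : NoRainbow G f
  minimal : ∀ g, IsProper G g → NoRainbow G g → (∀ x, IsMono G g x → IsMono G f x) →
    ∀ x, IsMono G f x → IsMono G g x

lemma exists_minimalColoring [Finite V] (h : ∃ f, IsProper G f ∧ NoRainbow G f) :
    ∃ f, IsMinimalColoring G f := by
  have : Nonempty {f : V → Fin 3 // IsProper G f ∧ NoRainbow G f} := by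
    obtain ⟨f, hf⟩ := h
    exact ⟨f, hf⟩
  obtain ⟨⟨f, hf, hn⟩, hmin⟩ := Finite.exists_min
    fun f : {f : V → Fin 3 // IsProper G f ∧ NoRainbow G f} => {x | IsMono G f.1 x}.ncard
  refine ⟨f, hf, hn, fun g hg hgn hsub x hx => ?_⟩
  have : {x | IsMono G g x} = {x | IsMono G f x} :=
    Set.eq_of_subset_of_ncard_le hsub (hmin ⟨g, hg, hgn⟩) (Set.toFinite _)
  exact this.ge hx

lemma color_eq_of_ne : ∀ {a b c d : Fin 3}, a ≠ b → c ≠ a → c ≠ b → d ≠ a → d ≠ b → d = c := by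
  decide

/-- If the color of a vertex `x` with a monochromatic neighborhood of size three cannot be changed,
then that change would create a rainbow copy of `L₀` with inner vertex `x`. -/
lemma IsMinimalColoring.exists_isL0 (h : IsMinimalColoring G f) (h3 : DegLeThree G)
    (tf : TriangleFree G) {x y : V} (hx : IsMono G f x) (hxy : G.Adj x y) (hy : IsMono G f y)
    (hl : ∀ l, G.Adj x l → ∃ z, z ≠ x ∧ G.Adj l z ∧ f z = f x) :
    ∃ v₁ v₃ v₄ u₁ u₂, IsL0 G v₁ x v₃ v₄ u₁ u₂ ∧ f v₁ = f v₃ ∧ f v₄ ≠ f x ∧ f v₄ ≠ f v₁ ∧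
      f u₁ = f x ∧ f u₂ = f x := by
  classical
  obtain ⟨k, hkx, hky⟩ := exists_color_ne (f x) (f y)
  have hxy' := h.proper x y hxy
  have hN : ∀ z, G.Adj x z → f z = f y := fun z hz => hx.color_eq h3 hz hxy
  obtain ⟨g, hg⟩ : ∃ g, g = Function.update f x k := ⟨_, rfl⟩
  have gx : g x = k := by simp [hg]
  have g0 : ∀ z, z ≠ x → g z = f z := fun z hz => by simp [hg, hz]
  have hp : IsProper G g := by
    intro a b hab
    by_cases ha : a = x
    · subst ha
      rw [gx, g0 b hab.ne', hN b hab]; exact hky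
    by_cases hb : b = x
    · subst hb
      rw [gx, g0 a ha, hN a hab.symm]; exact hky.symm
    rw [g0 a ha, g0 b hb]; exact h.proper a b hab
  have hnot : ∀ z, G.Adj x z → ¬ IsMono G g z := by
    intro z hz hm
    obtain ⟨w, hwx, hzw, hfw⟩ := hl z hz
    have := hm.color_eq h3 hz.symm hzw
    rw [gx, g0 w hwx, hfw] at this
    exact hkx this
  have hnr : ¬ NoRainbow G g := by
    intro hnr
    refine hnot y hxy (h.minimal g hp hnr (fun z hz => ?_) y hy)
    by_cases hzx : z = x
    · rwa [hzx]
    · exact hz.congr fun w hzw => g0 w (by rintro rfl; exact hnot z hzw.symm hz)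
  simp only [NoRainbow, not_forall, not_not] at hnr
  obtain ⟨v₁, v₂, v₃, v₄, u₁, u₂, hr⟩ := hnr
  have hxm : x ∈ ({v₁, v₂, v₃, v₄, u₁, u₂} : Set V) := by
    by_contra hxm
    exact h.noRainbow _ _ _ _ _ _ (hr.congr fun z hz => g0 z (by rintro rfl; exact hxm hz))
  have hgN : ∀ z, G.Adj x z → g z = f y := fun z hz => by rw [g0 z hz.ne', hN z hz]
  obtain ⟨w₁, w₃, w₄, t₁, t₂, hr', -⟩ := hr.exists_of_monochromatic hp hxm
    fun a _ b _ ha hb => (hgN a ha).trans (hgN b hb).symm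
  have hnd := hr'.1.nodup tf
  simp only [List.nodup_cons, List.mem_cons, List.not_mem_nil, or_false, not_or] at hnd
  have e4 : f w₄ = k := by rw [← g0 w₄ (Ne.symm hnd.2.1.2.1), ← hr'.color₂₄, gx]
  have c1 := hr'.color_u₁_ne hp
  have c2 := hr'.color_u₂_ne hp
  have c3 := hr'.color_u
  have e1 := hN w₁ hr'.1.adj₁₂.symm
  rw [g0 t₁ (Ne.symm hnd.2.1.2.2.1), hgN w₁ hr'.1.adj₁₂.symm] at c1
  rw [g0 t₁ (Ne.symm hnd.2.1.2.2.1), gx] at c2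
  rw [g0 t₁ (Ne.symm hnd.2.1.2.2.1), g0 t₂ (Ne.symm hnd.2.1.2.2.2)] at c3
  have ht : f t₁ = f x := color_eq_of_ne hky hkx.symm hxy' c2 c1
  exact ⟨w₁, w₃, w₄, t₁, t₂, hr'.1, e1.trans (hN w₃ hr'.1.adj₂₃).symm, by rwa [e4],
    by rwa [e4, e1], ht, c3 ▸ ht⟩

/-! ### The recoloring that removes a monochromatic neighborhood -/

section Recolor

variable {v₁ v₂ v₃ v₄ u₁ u₂ w w' : V}

/-- A copy of `L₀` that becomes rainbow when the color of `v₂` is changed, together with a path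
`v₃ w w'` that avoids it. -/
structure IsBlocked (G : SimpleGraph V) (f : V → Fin 3) (v₁ v₂ v₃ v₄ u₁ u₂ w w' : V) : Prop where
  isL0 : IsL0 G v₁ v₂ v₃ v₄ u₁ u₂
  mono : IsMono G f v₂
  color₁₃ : f v₁ = f v₃
  color₄₂ : f v₄ ≠ f v₂
  color₄₁ : f v₄ ≠ f v₁
  color_u₁ : f u₁ = f v₂
  color_u₂ : f u₂ = f v₂
  adj_w : G.Adj v₃ w
  w_ne : w ≠ v₂
  color_w : f w = f v₂
  adj_w' : G.Adj w w'
  w'_ne : w' ≠ v₃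
  color_w' : f w' = f v₁

/-- The coloring that gives the color of `v₄` to `v₁` and `v₃`, and the color of `v₁` to `v₄`. -/
structure IsRecoloring (f g : V → Fin 3) (v₁ v₃ v₄ : V) : Prop where
  eq₁ : g v₁ = f v₄
  eq₃ : g v₃ = f v₄
  eq₄ : g v₄ = f v₁
  eq : ∀ z, z ≠ v₁ → z ≠ v₃ → z ≠ v₄ → g z = f z

/-- The adjacencies and colors around a blocked vertex, after recoloring. -/
structure IsRecolored (G : SimpleGraph V) (g : V → Fin 3) (v₁ v₂ v₃ v₄ u₁ u₂ w w' : V)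
    (i j k : Fin 3) : Prop where
  ij : i ≠ j
  ik : i ≠ k
  jk : j ≠ k
  isL0 : IsL0 G v₁ v₂ v₃ v₄ u₁ u₂
  adj₁ : ∀ z, G.Adj v₁ z → z = u₁ ∨ z = u₂ ∨ z = v₂
  adj₄ : ∀ z, G.Adj v₄ z → z = u₁ ∨ z = u₂ ∨ z = v₃
  adj₃ : ∀ z, G.Adj v₃ z → z = v₂ ∨ z = v₄ ∨ z = w
  adj_w' : G.Adj w w'
  g₁ : g v₁ = k
  g₂ : g v₂ = i
  g₃ : g v₃ = k
  g₄ : g v₄ = j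
  gu₁ : g u₁ = i
  gu₂ : g u₂ = i
  gw : g w = i
  gw' : g w' = j
  g_adj₂ : ∀ z, G.Adj v₂ z → z ≠ v₁ → z ≠ v₃ → g z = j

lemma IsBlocked.isRecolored (h : IsBlocked G f v₁ v₂ v₃ v₄ u₁ u₂ w w') (h3 : DegLeThree G)
    (tf : TriangleFree G) (hf : IsProper G f) (hg : IsRecoloring f g v₁ v₃ v₄) :
    IsRecolored G g v₁ v₂ v₃ v₄ u₁ u₂ w w' (f v₂) (f v₁) (f v₄) := by
  have hnd := h.isL0.nodup tf
  simp only [List.nodup_cons, List.mem_cons, List.not_mem_nil, or_false, not_or] at hnd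
  obtain ⟨⟨n12, n13, n14, n1u, n1t⟩, ⟨n23, n24, n2u, n2t⟩, ⟨n34, n3u, n3t⟩, ⟨n4u, n4t⟩, nut, -⟩ := hnd
  have c12 := hf _ _ h.isL0.adj₁₂
  have hw4 : w ≠ v₄ := by rintro rfl; exact h.color₄₂ h.color_w
  have hw1 : w ≠ v₁ := by rintro rfl; exact c12 h.color_w
  have h43 : f v₄ ≠ f v₃ := by rw [← h.color₁₃]; exact h.color₄₁
  have hw'1 : w' ≠ v₁ := by
    rintro rfl
    rcases h.isL0.eq_of_adj tf h3 h.adj_w'.symm with rfl | rfl | rfl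
    · exact tf _ _ _ h.adj_w h.isL0.adj_u₁₄ h.isL0.adj₃₄
    · exact tf _ _ _ h.adj_w h.isL0.adj_u₂₄ h.isL0.adj₃₄
    · exact h.w_ne rfl
  refine ⟨c12.symm, h.color₄₂.symm, h.color₄₁.symm, h.isL0, fun z => h.isL0.eq_of_adj tf h3,
    fun z => h.isL0.reverse.eq_of_adj tf h3, fun z => h3.eq_of_adj h.isL0.adj₂₃.symm h.isL0.adj₃₄
    h.adj_w n24 h.w_ne.symm hw4.symm, h.adj_w', hg.eq₁, hg.eq _ (Ne.symm n12) n23 n24, hg.eq₃,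
    hg.eq₄, ?_, ?_, ?_, ?_, fun z hz h1 h3' => ?_⟩
  · rw [hg.eq _ (Ne.symm n1u) (Ne.symm n3u) (Ne.symm n4u), h.color_u₁]
  · rw [hg.eq _ (Ne.symm n1t) (Ne.symm n3t) (Ne.symm n4t), h.color_u₂]
  · rw [hg.eq _ hw1 h.adj_w.ne' hw4, h.color_w]
  · rw [hg.eq _ hw'1 h.w'_ne (by rintro rfl; exact h.color₄₁ h.color_w'), h.color_w']
  · have hz1 := h.mono.color_eq h3 hz h.isL0.adj₁₂.symm
    rw [hg.eq _ h1 h3' (by rintro rfl; exact h.color₄₁ hz1), hz1]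

variable {i j k : Fin 3} {w₁ w₂ w₃ w₄ t₁ t₂ a₁ a₂ a₃ a₄ b₁ b₂ : V}

namespace IsRecolored

lemma swap (h : IsRecolored G g v₁ v₂ v₃ v₄ u₁ u₂ w w' i j k) :
    IsRecolored G g v₁ v₂ v₃ v₄ u₂ u₁ w w' i j k :=
  { h with
    isL0 := h.isL0.swap
    adj₁ := fun z hz => by have := h.adj₁ z hz; tauto
    adj₄ := fun z hz => by have := h.adj₄ z hz; tauto
    gu₁ := h.gu₂
    gu₂ := h.gu₁ }

lemma false_of_w₁_eq_u_aux (h : IsRecolored G g v₁ v₂ v₃ v₄ u₁ u₂ w w' i j k)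
    (hr : IsRainbowL0 G g w₁ v₁ w₃ w₄ v₄ t₂) : False := by
  have h4 : w₄ = v₃ := by
    have e := hr.color₂₄
    rw [h.g₁] at e
    rcases h.adj₄ _ hr.1.adj_u₁₄ with rfl | rfl | rfl
    · exact absurd (h.gu₁.symm.trans e.symm) h.ik
    · exact absurd (h.gu₂.symm.trans e.symm) h.ik
    · rfl
  subst h4
  have e := hr.color_u
  rw [h.g₄] at e
  rcases h.adj₃ _ hr.1.adj_u₂₄.symm with rfl | rfl | rfl
  · exact h.ij (h.g₂.symm.trans e.symm)
  · exact hr.1.ne rfl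
  · exact h.ij (h.gw.symm.trans e.symm)

lemma false_of_w₁_eq_u (h : IsRecolored G g v₁ v₂ v₃ v₄ u₁ u₂ w w' i j k) (h3 : DegLeThree G)
    (tf : TriangleFree G) (hr : IsRainbowL0 G g u₁ v₁ w₃ w₄ t₁ t₂) : False := by
  rcases hr.1.eq_of_adj tf h3 h.isL0.adj_u₁₄ with rfl | rfl | h'
  · exact h.false_of_w₁_eq_u_aux hr
  · exact h.false_of_w₁_eq_u_aux hr.swap
  · exact h.jk (by rw [← h.g₄, h', h.g₁])

lemma not_mem₁ (h : IsRecolored G g v₁ v₂ v₃ v₄ u₁ u₂ w w' i j k) (h3 : DegLeThree G)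
    (tf : TriangleFree G) (hg : IsProper G g) (hr : IsRainbowL0 G g a₁ a₂ a₃ a₄ b₁ b₂) :
    v₁ ∉ ({a₁, a₂, a₃, a₄, b₁, b₂} : Set V) := by
  intro hm
  have hcol : ∀ x, G.Adj v₁ x → g x = i := by
    intro x hx
    rcases h.adj₁ x hx with rfl | rfl | rfl
    exacts [h.gu₁, h.gu₂, h.g₂]
  obtain ⟨w₁, w₃, w₄, t₁, t₂, hr', -⟩ := hr.exists_of_monochromatic hg hm
    fun x _ y _ hx hy => (hcol x hx).trans (hcol y hy).symm
  rcases h.adj₁ _ hr'.1.adj₁₂.symm with rfl | rfl | rfl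
  · exact h.false_of_w₁_eq_u h3 tf hr'
  · exact h.swap.false_of_w₁_eq_u h3 tf hr'
  · have hc : g v₃ = g v₁ := h.g₃.trans h.g₁.symm
    rcases hr'.1.eq_of_adj tf h3 h.isL0.adj₂₃ with rfl | rfl | rfl
    · exact hr'.color_u₂_ne hg hc
    · exact hr'.swap.color_u₂_ne hg hc
    · exact tf _ _ _ h.isL0.adj₃₄ h.isL0.adj_u₁₄.symm h.isL0.adj_u₁₁.symm

lemma false_of_t₁_eq_v₄ (h : IsRecolored G g v₁ v₂ v₃ v₄ u₁ u₂ w w' i j k)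
    (hr : IsRainbowL0 G g v₃ w₂ w₃ w₄ v₄ t₂) : False := by
  have e := hr.color_u
  rw [h.g₄] at e
  rcases h.adj₃ _ hr.1.adj_u₂₁.symm with rfl | rfl | rfl
  · exact h.ij (h.g₂.symm.trans e.symm)
  · exact hr.1.ne rfl
  · exact h.ij (h.gw.symm.trans e.symm)

lemma not_mem₄ (h : IsRecolored G g v₁ v₂ v₃ v₄ u₁ u₂ w w' i j k) (h3 : DegLeThree G)
    (tf : TriangleFree G) (hg : IsProper G g) (hr : IsRainbowL0 G g a₁ a₂ a₃ a₄ b₁ b₂) :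
    v₄ ∉ ({a₁, a₂, a₃, a₄, b₁, b₂} : Set V) := by
  intro hm
  have h1 := h.not_mem₁ h3 tf hg hr
  obtain ⟨w₁, w₂, w₃, w₄, t₁, t₂, hr', hset, hz⟩ := hr.wlog_mem hm
  rw [← hset] at h1
  simp only [Set.mem_insert_iff, Set.mem_singleton_iff, not_or] at h1
  have hnd := hr'.1.nodup tf
  simp only [List.nodup_cons, List.mem_cons, not_or] at hnd
  have gu₁ := h.gu₁
  have gu₂ := h.gu₂
  have g₃ := h.g₃
  have ik := h.ik
  rcases hz with rfl | rfl | rfl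
  · have c1 := hr'.color_u
    have c2 := hr'.color_u₂_ne hg
    have n := hr'.1.ne
    have e1 := h.adj₄ _ hr'.1.adj_u₁₁.symm
    have e2 := h.adj₄ _ hr'.1.adj_u₂₁.symm
    have e3 := h.adj₄ _ hr'.1.adj₁₂
    have hw : w₂ = v₃ := by grind only
    subst hw
    have e := hr'.color₁₃
    rw [h.g₄] at e
    rcases h.adj₃ _ hr'.1.adj₂₃ with rfl | rfl | rfl
    · exact h.ij (h.g₂.symm.trans e.symm)
    · exact hnd.1.2.1 rfl
    · exact h.ij (h.gw.symm.trans e.symm)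
  · have hv : ∀ u, G.Adj u v₁ → w₁ = u → False := by
      rintro u hu rfl
      rcases hr'.1.eq_of_adj tf h3 hu with h' | h' | h' <;> tauto
    rcases h.adj₄ _ hr'.1.adj₁₂.symm with hw | hw | hw
    · exact hv _ h.isL0.adj_u₁₁ hw
    · exact hv _ h.isL0.adj_u₂₁ hw
    · have e := hr'.color₁₃
      have n := hnd.1.2.1
      have := h.adj₄ _ hr'.1.adj₂₃
      grind only
  · have e1 := h.adj₄ _ hr'.1.adj_u₁₁
    have e2 := h.adj₄ _ hr'.1.adj_u₁₄
    have c := hr'.color₁₂_ne hg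
    rw [hr'.color₂₄] at c
    have : w₁ = v₃ ∨ w₄ = v₃ := by grind only
    rcases this with rfl | rfl
    · exact h.false_of_t₁_eq_v₄ hr'
    · exact h.false_of_t₁_eq_v₄ hr'.reverse

lemma not_mem₃ (h : IsRecolored G g v₁ v₂ v₃ v₄ u₁ u₂ w w' i j k) (h3 : DegLeThree G)
    (tf : TriangleFree G) (hg : IsProper G g) (hr : IsRainbowL0 G g a₁ a₂ a₃ a₄ b₁ b₂) :
    v₃ ∉ ({a₁, a₂, a₃, a₄, b₁, b₂} : Set V) := by
  intro hm
  have h1 := h.not_mem₁ h3 tf hg hr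
  have h4 := h.not_mem₄ h3 tf hg hr
  have hN : ∀ x ∈ ({a₁, a₂, a₃, a₄, b₁, b₂} : Set V), G.Adj v₃ x → x = v₂ ∨ x = w := by
    intro x hx hvx
    rcases h.adj₃ x hvx with rfl | rfl | rfl
    exacts [Or.inl rfl, absurd hx h4, Or.inr rfl]
  have hcol : ∀ x ∈ ({a₁, a₂, a₃, a₄, b₁, b₂} : Set V), G.Adj v₃ x → g x = i := by
    intro x hx hvx
    rcases hN x hx hvx with rfl | rfl
    exacts [h.g₂, h.gw]
  obtain ⟨w₁, w₃, w₄, t₁, t₂, hr', hset⟩ := hr.exists_of_monochromatic hg hm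
    fun x hx y hy hvx hvy => (hcol x hx hvx).trans (hcol y hy hvy).symm
  rw [← hset] at hN h1 h4
  simp only [Set.mem_insert_iff, Set.mem_singleton_iff, not_or] at h1 h4
  have hnd := hr'.1.nodup tf
  simp only [List.nodup_cons, List.mem_cons, not_or] at hnd
  have hw3 := hN w₃ (by simp) hr'.1.adj₂₃
  rcases hN w₁ (by simp) hr'.1.adj₁₂.symm with rfl | rfl
  · rcases hr'.1.eq_of_adj tf h3 h.isL0.adj₁₂.symm with h' | h' | h' <;> tauto
  · rcases hw3 with rfl | rfl
    · have e := h.g_adj₂ _ hr'.1.adj₃₄ (by tauto) (Ne.symm hnd.2.1.2.1)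
      rw [← hr'.color₂₄, h.g₃] at e
      exact h.jk e.symm
    · exact hnd.1.2.1 rfl

end IsRecolored

lemma IsMinimalColoring.not_isBlocked (hf : IsMinimalColoring G f) (h3 : DegLeThree G)
    (tf : TriangleFree G) : ¬ IsBlocked G f v₁ v₂ v₃ v₄ u₁ u₂ w w' := by
  classical
  intro hb
  have hnd := hb.isL0.nodup tf
  simp only [List.nodup_cons, List.mem_cons, not_or] at hnd
  have n13 : v₁ ≠ v₃ := hnd.1.2.1
  have n14 : v₁ ≠ v₄ := hnd.1.2.2.1
  obtain ⟨g, hg⟩ : ∃ g, IsRecoloring f g v₁ v₃ v₄ := by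
    refine ⟨fun z => if z = v₁ ∨ z = v₃ then f v₄ else if z = v₄ then f v₁ else f z, ?_, ?_, ?_, ?_⟩
    · simp
    · simp
    · simp [n14.symm, hb.isL0.adj₃₄.ne']
    · intro z h1 h3 h4
      simp [h1, h3, h4]
  have h := hb.isRecolored h3 tf hf.proper hg
  have key : ∀ z, z = v₁ ∨ z = v₃ ∨ z = v₄ → ∀ y, G.Adj z y → g z ≠ g y := by
    intro z hz y hzy
    rcases hz with rfl | rfl | rfl
    · rcases h.adj₁ y hzy with rfl | rfl | rfl
      · rw [h.g₁, h.gu₁]; exact h.ik.symm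
      · rw [h.g₁, h.gu₂]; exact h.ik.symm
      · rw [h.g₁, h.g₂]; exact h.ik.symm
    · rcases h.adj₃ y hzy with rfl | rfl | rfl
      · rw [h.g₃, h.g₂]; exact h.ik.symm
      · rw [h.g₃, h.g₄]; exact h.jk.symm
      · rw [h.g₃, h.gw]; exact h.ik.symm
    · rcases h.adj₄ y hzy with rfl | rfl | rfl
      · rw [h.g₄, h.gu₁]; exact h.ij.symm
      · rw [h.g₄, h.gu₂]; exact h.ij.symm
      · rw [h.g₄, h.g₃]; exact h.jk
  have hp : IsProper G g := by
    intro x y hxy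
    by_cases hx : x = v₁ ∨ x = v₃ ∨ x = v₄
    · exact key x hx y hxy
    by_cases hy : y = v₁ ∨ y = v₃ ∨ y = v₄
    · exact (key y hy x hxy.symm).symm
    push Not at hx hy
    rw [hg.eq x hx.1 hx.2.1 hx.2.2, hg.eq y hy.1 hy.2.1 hy.2.2]
    exact hf.proper x y hxy
  have hnr : NoRainbow G g := by
    intro a₁ a₂ a₃ a₄ b₁ b₂ hr
    refine hf.noRainbow _ _ _ _ _ _ (hr.congr fun z hz => hg.eq z ?_ ?_ ?_)
    · rintro rfl; exact h.not_mem₁ h3 tf hp hr hz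
    · rintro rfl; exact h.not_mem₃ h3 tf hp hr hz
    · rintro rfl; exact h.not_mem₄ h3 tf hp hr hz
  have hu : ∀ u, G.Adj u v₁ → G.Adj u v₄ → ¬ IsMono G g u := by
    intro u h1 h4 hm
    have := hm.color_eq h3 h1 h4
    rw [h.g₁, h.g₄] at this
    exact h.jk this.symm
  have hv₂ : ¬ IsMono G g v₂ := by
    intro hm
    obtain ⟨a, b, c, ha, hb', hc, hab, hac, hbc, -⟩ := hb.mono
    obtain ⟨x, hx, hx1, hx3⟩ : ∃ x, G.Adj v₂ x ∧ x ≠ v₁ ∧ x ≠ v₃ := by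
      by_contra! hcon
      have h1 := or_iff_not_imp_left.2 (hcon a ha)
      have h2 := or_iff_not_imp_left.2 (hcon b hb')
      have h3 := or_iff_not_imp_left.2 (hcon c hc)
      clear hnd key h
      grind only
    have := hm.color_eq h3 hx hb.isL0.adj₂₃
    rw [h.g_adj₂ x hx hx1 hx3, h.g₃] at this
    exact h.jk this
  have hw : ¬ IsMono G g w := by
    intro hm
    have := hm.color_eq h3 hb.adj_w.symm hb.adj_w'
    rw [h.g₃, h.gw'] at this
    exact h.jk this.symm
  have h3' : ¬ IsMono G g v₃ := by
    intro hm
    have := hm.color_eq h3 hb.isL0.adj₂₃.symm hb.isL0.adj₃₄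
    rw [h.g₂, h.g₄] at this
    exact h.ij this
  have h4' : ¬ IsMono G g v₄ := by
    intro hm
    have := hm.color_eq h3 hb.isL0.adj_u₁₄.symm hb.isL0.adj₃₄.symm
    rw [h.gu₁, h.g₃] at this
    exact h.ik this
  refine hv₂ (hf.minimal g hp hnr (fun z hz => ?_) v₂ hb.mono)
  by_cases hz1 : z = v₁
  · subst hz1
    exact ⟨u₁, u₂, v₂, hb.isL0.adj_u₁₁.symm, hb.isL0.adj_u₂₁.symm, hb.isL0.adj₁₂, hb.isL0.ne,
      Ne.symm hnd.2.1.2.2.1, Ne.symm hnd.2.1.2.2.2.1, hb.color_u₁.trans hb.color_u₂.symm,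
      hb.color_u₁⟩
  · have hu₁ := hu u₁ hb.isL0.adj_u₁₁ hb.isL0.adj_u₁₄
    have hu₂ := hu u₂ hb.isL0.adj_u₂₁ hb.isL0.adj_u₂₄
    refine hz.congr fun y hzy => hg.eq y ?_ ?_ ?_
    · rintro rfl
      rcases h.adj₁ z hzy.symm with rfl | rfl | rfl <;> contradiction
    · rintro rfl
      rcases h.adj₃ z hzy.symm with rfl | rfl | rfl <;> contradiction
    · rintro rfl
      rcases h.adj₄ z hzy.symm with rfl | rfl | rfl <;> contradiction

end Recolor

/-- In a minimal coloring, a vertex with a monochromatic neighborhood that has such a neighbor but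
no leaf as a neighbor (in the graph induced by two colors) has a neighbor `s` of degree two whose
other neighbor `w` is a leaf. -/
lemma IsMinimalColoring.exists_support (hf : IsMinimalColoring G f) (h3 : DegLeThree G)
    (tf : TriangleFree G) {x y : V} (hx : IsMono G f x) (hxy : G.Adj x y) (hy : IsMono G f y)
    (hl : ∀ l, G.Adj x l → ∃ z, z ≠ x ∧ G.Adj l z ∧ f z = f x) :
    ∃ s w v, G.Adj x s ∧ G.Adj s w ∧ w ≠ x ∧ f w = f x ∧ f v ≠ f x ∧ f v ≠ f s ∧
      (∀ z, G.Adj s z → z = x ∨ z = w ∨ z = v) ∧ ∀ z, G.Adj w z → f z = f s → z = s := by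
  obtain ⟨v₁, v₃, v₄, u₁, u₂, hL, c13, c4x, c41, cu₁, cu₂⟩ := hf.exists_isL0 h3 tf hx hxy hy hl
  obtain ⟨w, hwx, hvw, hfw⟩ := hl v₃ hL.adj₂₃
  have hx4 : x ≠ v₄ := by rintro rfl; exact c4x rfl
  have hw4 : w ≠ v₄ := by rintro rfl; exact c4x hfw
  refine ⟨v₃, w, v₄, hL.adj₂₃, hvw, hwx, hfw, c4x, by rwa [← c13], fun z hz => ?_, ?_⟩
  · exact h3.eq_of_adj hL.adj₂₃.symm hvw hL.adj₃₄ hwx.symm hx4 hw4 hz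
  · intro z hwz hfz
    by_contra hne
    exact hf.not_isBlocked h3 tf ⟨hL, hx, c13, c4x, c41, cu₁, cu₂, hvw, hwx, hfw, hwz, hne,
      hfz.trans c13.symm⟩

end Minimal

section Good

variable {V : Type*} {G : SimpleGraph V} {f : V → Fin 3}

lemma exists_three_of_encard_le {α : Type*} (x₀ : α) {s : Set α} (h : s.encard ≤ 3) :
    ∃ a b c, ∀ x ∈ s, x = a ∨ x = b ∨ x = c := by
  have hfin : s.Finite := Set.finite_of_encard_le_coe h
  have hl : hfin.toFinset.toList.length ≤ 3 := by
    rw [Finset.length_toList]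
    rw [hfin.encard_eq_coe_toFinset_card] at h
    exact_mod_cast h
  have hm : ∀ x ∈ s, x ∈ hfin.toFinset.toList := by simp
  rcases hL : hfin.toFinset.toList with _ | ⟨a, _ | ⟨b, _ | ⟨c, _ | ⟨d, l⟩⟩⟩⟩
  · exact ⟨x₀, x₀, x₀, fun x hx => by have := hm x hx; simp [hL] at this⟩
  · exact ⟨a, a, a, fun x hx => by have := hm x hx; simp [hL] at this; tauto⟩
  · exact ⟨a, b, b, fun x hx => by have := hm x hx; simp [hL] at this; tauto⟩
  · exact ⟨a, b, c, fun x hx => by have := hm x hx; simp [hL] at this; tauto⟩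
  · rw [hL] at hl
    simp only [List.length_cons] at hl
    omega

lemma IsSubcubic.degLeThree (h : IsSubcubic G) : DegLeThree G := fun v =>
  exists_three_of_encard_le v (h v)

lemma triangleFree_of_cliqueFree (h : G.CliqueFree 3) : TriangleFree G := by
  classical
  intro a b c hab hbc hac
  exact h {a, b, c} (SimpleGraph.is3Clique_triple_iff.2 ⟨hab, hac, hbc⟩)

/-- The graph induced by two color classes. -/
abbrev twoColorGraph (G : SimpleGraph V) (f : V → Fin 3) (i j : Fin 3) :
    SimpleGraph {v | f v = i ∨ f v = j} :=
  G.induce {v | f v = i ∨ f v = j}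

variable {i j : Fin 3}

lemma DegLeThree.isSubcubic_twoColorGraph (h3 : DegLeThree G) :
    IsSubcubic (twoColorGraph G f i j) := by
  classical
  intro x
  obtain ⟨a, b, c, h⟩ := h3 x
  have hsub : Subtype.val '' (twoColorGraph G f i j).neighborSet x ⊆
      (({a, b, c} : Finset V) : Set V) := by
    rintro _ ⟨y, hy, rfl⟩
    have := h y hy
    simpa using this
  rw [deg, ← Subtype.val_injective.encard_image]
  refine (Set.encard_le_encard hsub).trans ?_
  rw [Set.encard_coe_eq_coe_finsetCard]
  exact_mod_cast Finset.card_le_three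

lemma two_colors : ∀ {i j a b c : Fin 3}, (a = i ∨ a = j) → (b = i ∨ b = j) → (c = i ∨ c = j) →
    a ≠ b → a ≠ c → b = c := by
  decide

lemma IsProper.isBipartite_twoColorGraph (hf : IsProper G f) :
    (twoColorGraph G f i j).IsBipartite := by
  refine ⟨SimpleGraph.Coloring.mk (fun x => if f x = i then 0 else 1) ?_⟩
  intro x y hxy
  have h1 := hf _ _ hxy
  have h2 := x.2
  have h3 := y.2
  simp only [Set.mem_ofPred_eq] at h2 h3
  by_cases hx : f x = i <;> by_cases hy : f y = i <;> simp_all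

variable {x y l s : {v | f v = i ∨ f v = j}}

lemma IsProper.isMono_of_deg (hf : IsProper G f) (hx : deg (twoColorGraph G f i j) x = 3) :
    IsMono G f x := by
  obtain ⟨a, b, c, hab, hac, hbc, hs⟩ := Set.encard_eq_three.1 hx
  have ha : (twoColorGraph G f i j).Adj x a := by
    change a ∈ (twoColorGraph G f i j).neighborSet x
    simp [hs]
  have hb : (twoColorGraph G f i j).Adj x b := by
    change b ∈ (twoColorGraph G f i j).neighborSet x
    simp [hs]
  have hc : (twoColorGraph G f i j).Adj x c := by
    change c ∈ (twoColorGraph G f i j).neighborSet x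
    simp [hs]
  exact ⟨a, b, c, ha, hb, hc, Subtype.coe_ne_coe.2 hab, Subtype.coe_ne_coe.2 hac,
    Subtype.coe_ne_coe.2 hbc, two_colors x.2 a.2 b.2 (hf _ _ ha) (hf _ _ hb),
    two_colors x.2 a.2 c.2 (hf _ _ ha) (hf _ _ hc)⟩

lemma exists_of_not_isLeaf (hf : IsProper G f) (hxl : (twoColorGraph G f i j).Adj x l)
    (hl : ¬ IsLeaf (twoColorGraph G f i j) l) : ∃ z, z ≠ x.1 ∧ G.Adj l z ∧ f z = f x := by
  by_contra! hcon
  refine hl ?_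
  have : (twoColorGraph G f i j).neighborSet l = {x} := by
    ext z
    refine ⟨fun hz => ?_, fun hz => ?_⟩
    · have hlz : G.Adj l z := hz
      have hc : f z = f x := two_colors l.2 z.2 x.2 (hf _ _ hlz) (hf _ _ hxl.symm)
      by_contra hne
      exact hcon z (fun h => hne (Subtype.ext h)) hlz hc
    · rw [Set.mem_singleton_iff.1 hz]; exact hxl.symm
  rw [IsLeaf, deg, this, Set.encard_singleton]

lemma isLeaf_of_forall (hf : IsProper G f) (hsl : (twoColorGraph G f i j).Adj s l)
    (h : ∀ z, G.Adj l z → f z = f s → z = s) : IsLeaf (twoColorGraph G f i j) l := by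
  by_contra hl
  obtain ⟨z, hz, hlz, hc⟩ := exists_of_not_isLeaf hf hsl hl
  exact hz (h z hlz hc)

/-- The vertex `s` is a support vertex of degree two, and all its neighbors but `x` are leaves. -/
structure IsSupportOfDegTwo {W : Type*} (K : SimpleGraph W) (x s : W) : Prop where
  adj : K.Adj x s
  isSupport : IsSupport K s
  deg_eq : deg K s = 2
  isLeaf : ∀ w, K.Adj s w → w ≠ x → IsLeaf K w

lemma IsMinimalColoring.exists_isSupportOfDegTwo (hf : IsMinimalColoring G f)
    (h3 : DegLeThree G) (tf : TriangleFree G) (hx : deg (twoColorGraph G f i j) x = 3)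
    (hy : deg (twoColorGraph G f i j) y = 3) (hxy : (twoColorGraph G f i j).Adj x y)
    (hl : ∀ l, (twoColorGraph G f i j).Adj x l → ¬ IsLeaf (twoColorGraph G f i j) l) :
    ∃ s, IsSupportOfDegTwo (twoColorGraph G f i j) x s := by
  have hxm := hf.proper.isMono_of_deg hx
  have hcol : ∀ s, G.Adj x s → f s = f y := fun s hs => hxm.color_eq h3 hs hxy
  have hmem : ∀ s, G.Adj x s → f s = i ∨ f s = j := fun s hs => by rw [hcol s hs]; exact y.2
  obtain ⟨s, w, v, hxs, hsw, hwx, hfw, hvx, hvs, hN, hleaf⟩ := hf.exists_support h3 tf hxm hxy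
    (hf.proper.isMono_of_deg hy)
    fun l hl' => exists_of_not_isLeaf hf.proper (l := ⟨l, hmem l hl'⟩) hl' (hl _ hl')
  have hwm : f w = i ∨ f w = j := by rw [hfw]; exact x.2
  have hvm : ¬ (f v = i ∨ f v = j) := fun hvm =>
    hvx (two_colors (hmem s hxs) hvm x.2 hvs.symm (hf.proper _ _ hxs.symm))
  let s' : {v | f v = i ∨ f v = j} := ⟨s, hmem s hxs⟩
  let w' : {v | f v = i ∨ f v = j} := ⟨w, hwm⟩
  have hs : (twoColorGraph G f i j).neighborSet s' = {x, w'} := by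
    ext z
    refine ⟨fun hz => ?_, fun hz => ?_⟩
    · rcases hN z hz with h | h | h
      · exact Or.inl (Subtype.ext h)
      · exact Or.inr (Subtype.ext h)
      · exact absurd (h ▸ z.2) hvm
    · rcases hz with rfl | rfl
      · exact hxs.symm
      · exact hsw
  have hw : IsLeaf (twoColorGraph G f i j) w' :=
    isLeaf_of_forall hf.proper (s := s') (l := w') hsw hleaf
  refine ⟨s', hxs, ⟨w', hsw, hw⟩, ?_, fun z hz hzx => ?_⟩
  · rw [deg, hs, Set.encard_pair]
    rintro rfl
    exact hwx rfl
  · have : z ∈ (twoColorGraph G f i j).neighborSet s' := hz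
    rw [hs] at this
    rcases this with rfl | rfl
    · exact absurd rfl hzx
    · exact hw

lemma not_isLeaf_of_deg {W : Type*} {K : SimpleGraph W} {x : W} {n : ℕ} (h : deg K x = n)
    (hn : n ≠ 1) : ¬ IsLeaf K x := by
  rw [IsLeaf, h]
  exact_mod_cast hn

theorem IsMinimalColoring.isGoodGraph (hf : IsMinimalColoring G f) (h3 : DegLeThree G)
    (tf : TriangleFree G) : IsGoodGraph (twoColorGraph G f i j) := by
  have three : ∀ {x : {v | f v = i ∨ f v = j}}, deg (twoColorGraph G f i j) x = 3 →
      ¬ IsLeaf (twoColorGraph G f i j) x := fun h => not_isLeaf_of_deg (n := 3) h (by norm_num)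
  have two : ∀ {x : {v | f v = i ∨ f v = j}}, deg (twoColorGraph G f i j) x = 2 →
      ¬ IsLeaf (twoColorGraph G f i j) x := fun h => not_isLeaf_of_deg (n := 2) h (by norm_num)
  have two_three : ∀ {x : {v | f v = i ∨ f v = j}}, deg (twoColorGraph G f i j) x = 2 →
      deg (twoColorGraph G f i j) x = 3 → False := fun h h' => by
    rw [h] at h'; exact absurd h' (by norm_num)
  have h3' : DegLeThree (twoColorGraph G f i j) := (h3.isSubcubic_twoColorGraph).degLeThree
  refine ⟨hf.proper.isBipartite_twoColorGraph, h3.isSubcubic_twoColorGraph, ?_, ?_, ?_, ?_⟩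
  · intro v hv hN
    have : ((twoColorGraph G f i j).neighborSet v).Nonempty := by
      rw [← Set.encard_ne_zero, ← deg, hv]; norm_num
    obtain ⟨y, hy⟩ := this
    obtain ⟨s, hs⟩ := hf.exists_isSupportOfDegTwo h3 tf hv (hN y hy) hy
      fun l hl => three (hN l hl)
    exact two_three hs.deg_eq (hN s hs.adj)
  · intro x y hxy hx hy
    by_cases hlx : ∃ l, (twoColorGraph G f i j).Adj x l ∧ IsLeaf (twoColorGraph G f i j) l
    · exact Or.inl (Or.inl hlx)
    by_cases hly : ∃ l, (twoColorGraph G f i j).Adj y l ∧ IsLeaf (twoColorGraph G f i j) l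
    · exact Or.inl (Or.inr hly)
    push Not at hlx hly
    obtain ⟨s, hs⟩ := hf.exists_isSupportOfDegTwo h3 tf hx hy hxy hlx
    obtain ⟨t, ht⟩ := hf.exists_isSupportOfDegTwo h3 tf hy hx hxy.symm hly
    exact Or.inr ⟨⟨s, hs.adj, hs.isSupport, hs.deg_eq⟩, ⟨t, ht.adj, ht.isSupport, ht.deg_eq⟩⟩
  · intro x y z hxy hyz hxz hx hy hz _ _ y' hyy' hy'x hy'z hy' w hw hwy
    have hN : ∀ l, (twoColorGraph G f i j).Adj y l → l = x ∨ l = z ∨ l = y' := fun l =>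
      h3'.eq_of_adj hxy.symm hyz hyy' hxz hy'x.symm hy'z.symm
    obtain ⟨s, hs⟩ := hf.exists_isSupportOfDegTwo h3 tf hy hz hyz fun l hl => by
      rcases hN l hl with rfl | rfl | rfl
      exacts [three hx, three hz, two hy']
    rcases hN s hs.adj with rfl | rfl | rfl
    · exact (two_three hs.deg_eq hx).elim
    · exact (two_three hs.deg_eq hz).elim
    · exact hs.isLeaf w hw hwy
  · intro x y z z₁ z₂ _ hyz _ _ hy hz hN h1 h2
    have hN' : ∀ l, (twoColorGraph G f i j).Adj z l → l = z₁ ∨ l = z₂ ∨ l = y := by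
      intro l hl
      have : l ∈ (twoColorGraph G f i j).neighborSet z := hl
      rw [hN] at this
      simpa using this
    have hge : ∀ {x : {v | f v = i ∨ f v = j}}, 2 ≤ deg (twoColorGraph G f i j) x →
        ¬ IsLeaf (twoColorGraph G f i j) x := by
      intro x hx hl
      rw [IsLeaf] at hl
      rw [hl] at hx
      exact absurd hx (by norm_num)
    obtain ⟨s, hs⟩ := hf.exists_isSupportOfDegTwo h3 tf hz hy hyz.symm fun l hl => by
      rcases hN' l hl with rfl | rfl | rfl
      exacts [hge h1, hge h2, three hy]
    rcases hN' s hs.adj with rfl | rfl | rfl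
    · exact Or.inl ⟨hs.isSupport, hs.deg_eq⟩
    · exact Or.inr ⟨hs.isSupport, hs.deg_eq⟩
    · exact (two_three hs.deg_eq hy).elim

lemma L0_adj {a b : Fin 6} (h : s(a, b) ∈ ({s(0, 1), s(1, 2), s(2, 3), s(4, 0), s(4, 3), s(5, 0),
    s(5, 3)} : Set (Sym2 (Fin 6)))) (hab : a ≠ b) : L0.Adj a b :=
  (SimpleGraph.fromEdgeSet_adj _).2 ⟨h, hab⟩

lemma isL0_of_embedding (c : L0 ↪g G) : IsL0 G (c 0) (c 1) (c 2) (c 3) (c 4) (c 5) where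
  adj₁₂ := c.map_adj_iff.2 (L0_adj (by simp) (by decide))
  adj₂₃ := c.map_adj_iff.2 (L0_adj (by simp) (by decide))
  adj₃₄ := c.map_adj_iff.2 (L0_adj (by simp) (by decide))
  adj_u₁₁ := c.map_adj_iff.2 (L0_adj (by simp) (by decide))
  adj_u₁₄ := c.map_adj_iff.2 (L0_adj (by simp) (by decide))
  adj_u₂₁ := c.map_adj_iff.2 (L0_adj (by simp) (by decide))
  adj_u₂₄ := c.map_adj_iff.2 (L0_adj (by simp) (by decide))
  ne := c.injective.ne (by decide)

/-- Every finite triangle-free subcubic graph without a subgraph `R₅` has a good coloring. -/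
theorem exists_isGoodColoring [Finite V] (hG : G.CliqueFree 3) (hs : IsSubcubic G)
    (hR : R5.Free G) : ∃ f : G.Coloring (Fin 3), IsGoodColoring f := by
  have tf := triangleFree_of_cliqueFree hG
  have h3 := hs.degLeThree
  obtain ⟨f, hf⟩ := exists_minimalColoring (exists_noRainbow tf h3 hR)
  refine ⟨SimpleGraph.Coloring.mk f fun {x y} hxy => hf.proper x y hxy, fun c hc => ?_,
    fun i j _ => hf.isGoodGraph h3 tf⟩
  obtain ⟨p, h4, h5, h0, h2, h1, h3⟩ := hc
  exact hf.noRainbow _ _ _ _ _ _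
    ⟨isL0_of_embedding c, h4.trans h5.symm, h0.trans h2.symm, h1.trans h3.symm⟩

end Good

/-! ### Fractionally critical graphs do not contain `R₅` -/

section Fractional

lemma R5_cubic (i : Fin 8) : ∃ a b c, R5.Adj i a ∧ R5.Adj i b ∧ R5.Adj i c ∧
    a ≠ b ∧ a ≠ c ∧ b ≠ c := by
  fin_cases i
  · exact ⟨1, 4, 5, by simp [R5]⟩
  · exact ⟨0, 2, 7, by simp [R5]⟩
  · exact ⟨1, 3, 6, by simp [R5]⟩
  · exact ⟨2, 4, 5, by simp [R5]⟩
  · exact ⟨0, 3, 6, by simp [R5]⟩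
  · exact ⟨0, 3, 7, by simp [R5]⟩
  · exact ⟨4, 2, 7, by simp [R5]⟩
  · exact ⟨5, 1, 6, by simp [R5]⟩

lemma R5_hasFracColoring : HasFracColoring R5 8 3 := by
  refine ⟨![{0, 1, 2}, {3, 4, 5}, {0, 6, 7}, {1, 2, 3}, {4, 6, 7}, {4, 5, 6}, {1, 3, 5},
    {0, 2, 7}], by decide, fun i j hij => ?_⟩
  simp only [R5, SimpleGraph.fromEdgeSet_adj, Set.mem_insert_iff, Set.mem_singleton_iff,
    Sym2.eq_iff] at hij
  obtain ⟨hij, -⟩ := hij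
  rcases hij with h | h | h | h | h | h | h | h | h | h | h | h <;>
    rcases h with ⟨rfl, rfl⟩ | ⟨rfl, rfl⟩ <;> decide

variable {V : Type*} {G : SimpleGraph V}

lemma exists_hasFracColoring [Finite V] (G : SimpleGraph V) :
    ∃ a : ℕ, 0 < a ∧ HasFracColoring G a 1 := by
  obtain ⟨n, ⟨e⟩⟩ := Finite.exists_equiv_fin V
  refine ⟨n + 1, n.succ_pos, fun v => {(e v).castSucc}, by simp, fun x y hxy => ?_⟩
  simpa using hxy.ne

lemma fracChromaticNumber_le {a b : ℕ} (ha : 0 < a) (hb : 0 < b) (h : HasFracColoring G a b) :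
    fracChromaticNumber G ≤ a / b :=
  csInf_le ⟨0, by rintro _ ⟨a, b, -, -, -, rfl⟩; positivity⟩ ⟨a, b, ha, hb, h, rfl⟩

lemma exists_hasFracColoring_of_lt [Finite V] {t : ℝ} (h : fracChromaticNumber G < t) :
    ∃ a b : ℕ, 0 < a ∧ 0 < b ∧ HasFracColoring G a b ∧ (a : ℝ) / b < t := by
  obtain ⟨a, ha, hc⟩ := exists_hasFracColoring G
  have hne : {r : ℝ | ∃ a b : ℕ, 0 < a ∧ 0 < b ∧ HasFracColoring G a b ∧ r = a / b}.Nonempty :=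
    ⟨_, a, 1, ha, one_pos, hc, rfl⟩
  obtain ⟨_, ⟨a, b, ha, hb, hc, rfl⟩, hlt⟩ := exists_lt_of_csInf_lt hne h
  exact ⟨a, b, ha, hb, hc, hlt⟩

/-- If `S` is a union of components, then fractional colorings of `S` and of its complement
combine. -/
lemma HasFracColoring.union {a b c d : ℕ} {S : Set V}
    (hS : HasFracColoring (G.induce S) a b) (hT : HasFracColoring (G.induce Sᶜ) c d)
    (hadj : ∀ x ∈ S, ∀ y, G.Adj x y → y ∈ S) :
    HasFracColoring G (max (a * d) (c * b)) (b * d) := by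
  classical
  obtain ⟨f, hf, hfd⟩ := hS
  obtain ⟨g, hg, hgd⟩ := hT
  let e₁ : Fin a × Fin d ↪ Fin (max (a * d) (c * b)) :=
    finProdFinEquiv.toEmbedding.trans (Fin.castLEEmb (le_max_left _ _))
  let e₂ : Fin c × Fin b ↪ Fin (max (a * d) (c * b)) :=
    finProdFinEquiv.toEmbedding.trans (Fin.castLEEmb (le_max_right _ _))
  refine ⟨fun v => if h : v ∈ S then (f ⟨v, h⟩ ×ˢ Finset.univ).map e₁
    else (g ⟨v, h⟩ ×ˢ Finset.univ).map e₂, fun v => ?_, fun x y hxy => ?_⟩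
  · by_cases h : v ∈ S
    · simp [h, hf]
    · simp [h, hg, mul_comm]
  · by_cases hx : x ∈ S
    · have hy := hadj x hx y hxy
      simp only [hx, hy, dif_pos]
      rw [Finset.disjoint_map, Finset.disjoint_product]
      exact Or.inl (hfd _ _ hxy)
    · have hy : y ∉ S := fun hy => hx (hadj y hy x hxy.symm)
      simp only [hx, hy, dif_neg, not_false_eq_true]
      rw [Finset.disjoint_map, Finset.disjoint_product]
      exact Or.inl (hgd _ _ hxy)

lemma IsFracCritical.free_R5 [Finite V] {t : ℝ} (ht : 8 / 3 ≤ t) (hG : IsFracCritical t G)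
    (hs : IsSubcubic G) : R5.Free G := by
  rintro ⟨φ⟩
  have h3 := hs.degLeThree
  let S : Set V := Set.range φ
  have hφ : ∀ i y, G.Adj (φ i) y → ∃ j, R5.Adj i j ∧ φ j = y := by
    intro i y hy
    obtain ⟨a, b, c, ha, hb, hc, hab, hac, hbc⟩ := R5_cubic i
    have hinj := φ.injective
    rcases h3.eq_of_adj (φ.toHom.map_adj ha) (φ.toHom.map_adj hb) (φ.toHom.map_adj hc)
      (hinj.ne hab) (hinj.ne hac) (hinj.ne hbc) hy with rfl | rfl | rfl
    exacts [⟨a, ha, rfl⟩, ⟨b, hb, rfl⟩, ⟨c, hc, rfl⟩]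
  have hadj : ∀ x ∈ S, ∀ y, G.Adj x y → y ∈ S := by
    rintro _ ⟨i, rfl⟩ y hy
    obtain ⟨j, -, hj⟩ := hφ i y hy
    exact ⟨j, hj⟩
  have hSc : HasFracColoring (G.induce S) 8 3 := by
    obtain ⟨ψ, hψ, hψd⟩ := R5_hasFracColoring
    refine ⟨fun x => ψ x.2.choose, fun x => hψ _, fun x y hxy => hψd _ _ ?_⟩
    have hxy' : G.Adj (φ x.2.choose) y := by
      rw [x.2.choose_spec]
      exact hxy
    obtain ⟨j, hj, hjy⟩ := hφ _ _ hxy'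
    rwa [← φ.injective (hjy.trans y.2.choose_spec.symm)]
  have hne : (⊤ : G.Subgraph).induce Sᶜ ≠ ⊤ := by
    intro h
    have : φ 0 ∈ ((⊤ : G.Subgraph).induce Sᶜ).verts := by rw [h]; trivial
    exact this ⟨0, rfl⟩
  obtain ⟨a, b, ha, hb, hc, hlt⟩ :=
    exists_hasFracColoring_of_lt ((hG.2 _ hne).trans_lt hG.1)
  have hT : HasFracColoring (G.induce Sᶜ) a b := by
    obtain ⟨g, hg, hgd⟩ := hc
    exact ⟨g, hg, fun x y hxy => hgd x y ⟨x.2, y.2, hxy⟩⟩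
  have hle := fracChromaticNumber_le (by positivity) (by positivity) (hSc.union hT hadj)
  refine absurd hle (not_le.2 ?_)
  have hb' : (0 : ℝ) < b := by exact_mod_cast hb
  rw [div_lt_iff₀ (by positivity)] at hlt ⊢
  push_cast
  have h8 := ht.trans_lt hG.1
  refine max_lt ?_ ?_ <;> nlinarith

end Fractional

end GoodColoring

theorem mainTheorem4 {V : Type*} [Finite V] (G : SimpleGraph V) :
    (∀ t : ℝ, 8 / 3 ≤ t → IsFracCritical t G → G.CliqueFree 3 → IsSubcubic G →
      ∃ f : G.Coloring (Fin 3), IsGoodColoring f) ∧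
    (IsTwoConnected G → IsSubcubic G → G.CliqueFree 3 → IsRFree G → IsLPrimeFree G →
      ∃ f : G.Coloring (Fin 3), IsGoodColoring f) := by
  refine ⟨fun t ht hG htf hs => exists_isGoodColoring htf hs (hG.free_R5 ht hs),
    fun _ hs htf hR _ => exists_isGoodColoring htf hs hR.2.2.2.2.1⟩
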